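/- Let $\mathcal L=\{H_i\}_{i\in I}$ and $\mathcal E=\{E_j\}_{j\in J}$ be partitions of the sure event $\Omega$ into nonempty events, with arbitrary index sets. For a set of events $\mathcal G$ let $\langle\mathcal G\rangle$ be the Boolean algebra it generates and $\langle\mathcal G\rangle^*$ the smallest Boolean algebra of events containing $\mathcal G$ and closed under arbitrary disjunctions and conjunctions. Let $\mathcal A_{\mathcal L},\mathcal A_{\mathcal E},\mathcal A$ be Boolean algebras of events with $\langle\mathcal L\rangle\subseteq\mathcal A_{\mathcal L}\subseteq\langle\mathcal L\rangle^*$, $\langle\mathcal E\rangle\subseteq\mathcal A_{\mathcal E}\subseteq\langle\mathcal E\rangle^*$ and $\langle\mathcal A_{\mathcal L}\cup\mathcal A_{\mathcal E}\rangle\subseteq\mathcal A\subseteq\langle\mathcal A_{\mathcal L}\cup\mathcal A_{\mathcal E}\rangle^*$, and put $\mathcal A^0=\mathcal A\setminus\{\emptyset\}$. A strategy is a map $\sigma:\mathcal A\times\mathcal L\to[0,1]$ such that, for every $i$, $\sigma(\cdot|H_i)$ is a finitely additive probability on $\mathcal A$ and $\sigma(F|H_i)=1$ whenever $F\wedge H_i=H_i$.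 Let $\sigma$ be a strategy and $\pi$ a finitely additive probability on $\mathcal A_{\mathcal L}$. A function $P:\mathcal G\to[0,1]$ on a set $\mathcal G$ of conditional events $E|H$ (with $H\neq\emptyset$) is a coherent conditional probability if for all $n\ge 1$, all $E_1|H_1,\dots,E_n|H_n\in\mathcal G$ and all real $s_1,\dots,s_n$, the gain $G=\sum_j s_j(\mathbf 1_{E_j}-P(E_j|H_j))\mathbf 1_{H_j}$ satisfies $\min G\le 0\le\max G$ over $H_1\vee\dots\vee H_n$. A full conditional probability (f.c.p.) on $\mathcal A$ is a map $P:\mathcal A\times\mathcal A^0\to[0,1]$ such that $P(E|H)=P(E\wedge H|H)$, $P(\cdot|H)$ is a finitely additive probability on $\mathcal A$, and $P(E\wedge F|H)=P(E|H)P(F|E\wedge H)$ whenever $H,E\wedge H\in\mathcal A^0$. Let $\mathbf P$ be the set of f.c.p.'s $\tilde P$ on $\mathcal A$ extending $\{\pi,\sigma\}$, i.e. with $\tilde P(\cdot|\Omega)=\pi$ on $\mathcal A_{\mathcal L}$ and $\tilde P(\cdot|H_i)=\sigma(\cdot|H_i)$ for all $i$, and let $\underline P(F|K)=\min_{\tilde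 P\in\mathbf P}\tilde P(F|K)$. Let $\mathbf P^{j}$ be the set of finitely additive probabilities $p$ on $\mathcal A$ with $p|_{\mathcal A_{\mathcal L}}=\pi$ such that $\{p,\sigma\}$ is a coherent conditional probability on $\mathcal A\times(\{\Omega\}\cup\mathcal L)$, and let $\underline P^{j}(F)=\min_{p\in\mathbf P^{j}}p(F)$, $\overline P^{j}(F)=\max_{p\in\mathbf P^{j}}p(F)$. For $F\in\mathcal A$, $K\in\mathcal A^0$ let $$L^{j}(F,K)=\min\{p(F\wedge K): p\in\mathbf P^{j},\ p(F^c\wedge K)=\overline P^{j}(F^c\wedge K)\},$$ $$U^{j}(F,K)=\max\{p(F\wedge K): p\in\mathbf P^{j},\ p(F^c\wedge K)=\underline P^{j}(F^c\wedge K)\},$$ $$I_2^{F|K}=\{i\in I: H_i\wedge F\wedge K\neq\emptyset\neq H_i\wedge F^c\wedge K\},\qquad I_3^{F|K}=\{i\in I: H_i\wedge F\wedge K=\emptyset\neq H_i\wedge F^c\wedge K\}.$$ Then all these minima and maxima are attained (in particular $\mathbf P$ and $\mathbf P^{j}$ are nonempty), and for all $F\in\mathcal A$ and $K\in\mathcal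 A^0$ one has $\underline P(F|K)=1$ if $F\wedge K=K$, while if $F\wedge K\neq K$: (i) if $\underline P^{j}(K)>0$, then $$\underline P(F|K)=\min\left\{\frac{\underline P^{j}(F\wedge K)}{\underline P^{j}(F\wedge K)+U^{j}(F^c,K)},\ \frac{L^{j}(F,K)}{L^{j}(F,K)+\overline P^{j}(F^c\wedge K)}\right\};$$ (ii) if $\underline P^{j}(K)=0$, then $$\underline P(F|K)=\min_{i\in I_2^{F|K}}\frac{\sigma(F\wedge K|H_i)}{\sigma(K|H_i)}$$ if $I_2^{F|K}\neq\emptyset=I_3^{F|K}$, $I_2^{F|K}$ is finite and $\sigma(K|H_i)>0$ for all $i\in I_2^{F|K}$, and $\underline P(F|K)=0$ otherwise. -/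

import Mathlib

/-!  Events are subsets of a sample space `Ω`; the sure event is `univ`, the impossible event is `∅`. -/

/-- The family `H` is a partition of the sure event into non-impossible events. -/
def IsPartition {Ω ι : Type*} (H : ι → Set Ω) : Prop :=
  (∀ i, (H i).Nonempty) ∧ Pairwise (fun i j => Disjoint (H i) (H j)) ∧ ⋃ i, H i = Set.univ

/-- The complete atomic Boolean algebra `⟨S⟩*` generated by a set `S` of events: the smallest
algebra of events that contains `S` and is closed under arbitrary disjunctions
(hence, taking complements, under arbitrary conjunctions). -/
def completeAlgebra {Ω : Type*} (S : Set (Set Ω)) : Set (Set Ω) :=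
  {X | ∀ B : BooleanSubalgebra (Set Ω), S ⊆ (B : Set (Set Ω)) →
    (∀ T : Set (Set Ω), T ⊆ (B : Set (Set Ω)) → ⋃₀ T ∈ B) → X ∈ B}

/-- `p` is a finitely additive probability on the algebra `A` (values off `A` are irrelevant). -/
structure IsFinAddProb {Ω : Type*} (A : BooleanSubalgebra (Set Ω)) (p : Set Ω → ℝ) : Prop where
  nonneg : ∀ E ∈ A, 0 ≤ p E
  univ_eq : p Set.univ = 1
  add : ∀ E ∈ A, ∀ F ∈ A, Disjoint E F → p (E ∪ F) = p E + p F

/-- `σ F (H i)` is the value `σ(F|H_i)` of a strategy on `A × {H_i}`. -/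
structure IsStrategy {Ω ι : Type*} (A : BooleanSubalgebra (Set Ω)) (H : ι → Set Ω)
    (σ : Set Ω → Set Ω → ℝ) : Prop where
  eq_one : ∀ i, ∀ F ∈ A, F ∩ H i = H i → σ F (H i) = 1
  finAdd : ∀ i, IsFinAddProb A (fun F => σ F (H i))

/-- The random gain of the bets with stakes `s j` on the conditional events `(e j).1 | (e j).2`,
when the assessment is `P`. -/
noncomputable def gain {Ω : Type*} (P : Set Ω → Set Ω → ℝ) {n : ℕ}
    (e : Fin n → Set Ω × Set Ω) (s : Fin n → ℝ) (ω : Ω) : ℝ :=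
  ∑ j, s j * ((e j).1.indicator (fun _ => (1 : ℝ)) ω - P (e j).1 (e j).2)
    * (e j).2.indicator (fun _ => (1 : ℝ)) ω

/-- `P` is a coherent conditional probability on the set `G` of conditional events `E|H`, written
as pairs `(E, H)`.  A gain takes finitely many values, so `min ≤ 0 ≤ max` over the disjunction
of the conditioning events says that it is `≤ 0` somewhere there and `≥ 0` somewhere there. -/
structure IsCoherent {Ω : Type*} (G : Set (Set Ω × Set Ω)) (P : Set Ω → Set Ω → ℝ) : Prop where
  cond_nonempty : ∀ e ∈ G, e.2.Nonempty
  mem_Icc : ∀ e ∈ G, P e.1 e.2 ∈ Set.Icc (0 : ℝ) 1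
  gain_bounds : ∀ (n : ℕ), 0 < n → ∀ (e : Fin n → Set Ω × Set Ω) (s : Fin n → ℝ),
    (∀ j, e j ∈ G) →
      (∃ ω ∈ ⋃ j, (e j).2, gain P e s ω ≤ 0) ∧ (∃ ω ∈ ⋃ j, (e j).2, 0 ≤ gain P e s ω)

/-- `P` is a full conditional probability on `A`, i.e. a conditional probability with domain
`A × (A \ {∅})`; `P E K` is the value `P(E|K)`. -/
structure IsFullCondProb {Ω : Type*} (A : BooleanSubalgebra (Set Ω))
    (P : Set Ω → Set Ω → ℝ) : Prop where
  inter_cond : ∀ E ∈ A, ∀ K ∈ A, K.Nonempty → P E K = P (E ∩ K) K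
  finAdd : ∀ K ∈ A, K.Nonempty → IsFinAddProb A (fun E => P E K)
  chain : ∀ E ∈ A, ∀ F ∈ A, ∀ K ∈ A, K.Nonempty → (E ∩ K).Nonempty →
    P (E ∩ F) K = P E K * P F (E ∩ K)

/-- The full conditional probabilities on `A` extending `{π, σ}`. -/
def fullExtensions {Ω ι : Type*} (A AL : BooleanSubalgebra (Set Ω)) (H : ι → Set Ω)
    (π : Set Ω → ℝ) (σ : Set Ω → Set Ω → ℝ) : Set (Set Ω → Set Ω → ℝ) :=
  {P | IsFullCondProb A P ∧ (∀ B ∈ AL, P B Set.univ = π B) ∧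
    ∀ F ∈ A, ∀ i, P F (H i) = σ F (H i)}

/-- The joint probabilities on `A` consistent with `{π, σ}`: finitely additive probabilities `p`
on `A` that restrict to `π` on `AL`, such that `{p, σ}` is a coherent conditional probability
`Q` on `A × ({Ω} ∪ {H_i})`. -/
def jointProbs {Ω ι : Type*} (A AL : BooleanSubalgebra (Set Ω)) (H : ι → Set Ω)
    (π : Set Ω → ℝ) (σ : Set Ω → Set Ω → ℝ) : Set (Set Ω → ℝ) :=
  {p | IsFinAddProb A p ∧ (∀ B ∈ AL, p B = π B) ∧
    ∃ Q : Set Ω → Set Ω → ℝ,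
      (∀ F ∈ A, Q F Set.univ = p F) ∧ (∀ F ∈ A, ∀ i, Q F (H i) = σ F (H i)) ∧
      IsCoherent ((A : Set (Set Ω)) ×ˢ ({Set.univ} ∪ Set.range H)) Q}

section envelopes

variable {Ω ι : Type*} (A AL : BooleanSubalgebra (Set Ω)) (H : ι → Set Ω)
  (π : Set Ω → ℝ) (σ : Set Ω → Set Ω → ℝ)

/-- The values `P(F|K)` of the full conditional probabilities extending `{π, σ}`. -/
def extensionValues (F K : Set Ω) : Set ℝ :=
  (fun P : Set Ω → Set Ω → ℝ => P F K) '' fullExtensions A AL H π σ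

/-- The lower envelope of the full conditional probabilities extending `{π, σ}`. -/
noncomputable def lowerEnvelope (F K : Set Ω) : ℝ :=
  sInf (extensionValues A AL H π σ F K)

/-- The values `p(F)` of the consistent joint probabilities. -/
def jointValues (F : Set Ω) : Set ℝ :=
  (fun p : Set Ω → ℝ => p F) '' jointProbs A AL H π σ

/-- The lower joint probability. -/
noncomputable def lowerJoint (F : Set Ω) : ℝ := sInf (jointValues A AL H π σ F)

/-- The upper joint probability. -/
noncomputable def upperJoint (F : Set Ω) : ℝ := sSup (jointValues A AL H π σ F)

/-- The values `p(F ∧ K)` of the consistent joint probabilities with maximal `p(Fᶜ ∧ K)`. -/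
def lowerAuxValues (F K : Set Ω) : Set ℝ :=
  (fun p : Set Ω → ℝ => p (F ∩ K)) ''
    {p | p ∈ jointProbs A AL H π σ ∧ p (Fᶜ ∩ K) = upperJoint A AL H π σ (Fᶜ ∩ K)}

/-- The values `p(F ∧ K)` of the consistent joint probabilities with minimal `p(Fᶜ ∧ K)`. -/
def upperAuxValues (F K : Set Ω) : Set ℝ :=
  (fun p : Set Ω → ℝ => p (F ∩ K)) ''
    {p | p ∈ jointProbs A AL H π σ ∧ p (Fᶜ ∩ K) = lowerJoint A AL H π σ (Fᶜ ∩ K)}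

/-- The function `L(F, K)`. -/
noncomputable def lowerAux (F K : Set Ω) : ℝ := sInf (lowerAuxValues A AL H π σ F K)

/-- The function `U(F, K)`. -/
noncomputable def upperAux (F K : Set Ω) : ℝ := sSup (upperAuxValues A AL H π σ F K)

end envelopes

/-- The indices `i` for which `H i` meets both `F ∧ K` and `Fᶜ ∧ K`. -/
def indexTwo {Ω ι : Type*} (H : ι → Set Ω) (F K : Set Ω) : Set ι :=
  {i | H i ∩ F ∩ K ≠ ∅ ∧ H i ∩ Fᶜ ∩ K ≠ ∅}

/-- The indices `i` for which `H i` meets `Fᶜ ∧ K` but not `F ∧ K`. -/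
def indexThree {Ω ι : Type*} (H : ι → Set Ω) (F K : Set Ω) : Set ι :=
  {i | H i ∩ F ∩ K = ∅ ∧ H i ∩ Fᶜ ∩ K ≠ ∅}

/-! ### Finitely additive measures on an algebra, point masses, and finite partitions into atoms. -/

section FinAdd

variable {Ω : Type*} {A : BooleanSubalgebra (Set Ω)} {E F : Set Ω}

/-! Coherence of `{p, σ}` amounts to `p(F ∩ H i) = σ(F|H i) π(H i)` for all `F` and `i` (`IsJoint`):
a constant gain forces the identity, and conversely the identity gives every gain expectation zero
under a suitable probability.

The decisive fact is `exists_isJoint_le`: for `S ⊆ S'` a single joint probability minimises both. On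
a finite partition by events of `AL`, the mass of a cell `H i` is spread by `σ`, while the mass of
any other cell sits at a point outside `S'` if possible, else outside `S`. Such a point costs
nothing unless the cell lies inside the event, where the cost is unavoidable. An ultrafilter limit
over finite families yields the joint probability. With `S = X` and `S' = Yᶜ`, the lower probability
of `X` and the upper probability of a disjoint `Y` are attained together. Hence `L(F,K)` is the
lower probability of `F ∩ K` and `U(Fᶜ,K)` the upper probability of `Fᶜ ∩ K`; the two ratios in (i)
coincide, and monotonicity of `x/(x+y)` gives the bound.

If some joint `p` has `p K = 0`, then `P(·|K)` is left to lower layers of a full conditional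
probability. `exists_fullExtension` builds one as a limit of ratios of `p + ε m + ε³ ρ`, where `m`
is a free layer respecting `σ` asymptotically and `ρ` charges every nonempty event. Taking `m` to be
`σ(·|H i)` tilted towards a point of `K`, or a point mass of `Fᶜ ∩ K` escaping from every `H i`,
attains the values in (ii). For the nonzero value, `P(F|K ∩ H i)` is forced by `σ` on finitely many
cells that cover `Fᶜ ∩ K`, which gives the matching lower bound. -/

theorem BooleanSubalgebra.inter_mem (hE : E ∈ A) (hF : F ∈ A) : E ∩ F ∈ A := A.infClosed hE hF

theorem BooleanSubalgebra.union_mem (hE : E ∈ A) (hF : F ∈ A) : E ∪ F ∈ A := A.supClosed hE hF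

theorem BooleanSubalgebra.setCompl_mem (hE : E ∈ A) : Eᶜ ∈ A := A.compl_mem hE

theorem BooleanSubalgebra.diff_mem (hE : E ∈ A) (hF : F ∈ A) : E \ F ∈ A :=
  A.inter_mem hE (A.setCompl_mem hF)

theorem BooleanSubalgebra.univ_mem (A : BooleanSubalgebra (Set Ω)) : Set.univ ∈ A := A.top_mem

theorem BooleanSubalgebra.empty_mem (A : BooleanSubalgebra (Set Ω)) : ∅ ∈ A := A.bot_mem

theorem BooleanSubalgebra.biUnion_mem {α : Type*} (s : Finset α) (X : α → Set Ω)
    (h : ∀ a ∈ s, X a ∈ A) : (⋃ a ∈ s, X a) ∈ A := by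
  classical
  induction s using Finset.induction_on with
  | empty => simpa using A.empty_mem
  | insert a s ha ih =>
    rw [Finset.set_biUnion_insert]
    exact A.union_mem (h a (by simp)) (ih fun b hb => h b (by simp [hb]))

/-- `m` is a finitely additive, nonnegative measure on the algebra `A`. -/
structure IsFinAddMeasure (A : BooleanSubalgebra (Set Ω)) (m : Set Ω → ℝ) : Prop where
  nonneg : ∀ E ∈ A, 0 ≤ m E
  add : ∀ E ∈ A, ∀ F ∈ A, Disjoint E F → m (E ∪ F) = m E + m F

theorem IsFinAddProb.toMeasure {p : Set Ω → ℝ} (h : IsFinAddProb A p) : IsFinAddMeasure A p :=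
  ⟨h.nonneg, h.add⟩

namespace IsFinAddMeasure

variable {m m' : Set Ω → ℝ}

theorem empty (hm : IsFinAddMeasure A m) : m ∅ = 0 := by
  have := hm.add ∅ A.empty_mem ∅ A.empty_mem (by simp)
  simp only [Set.union_empty] at this
  linarith

theorem inter_add_diff (hm : IsFinAddMeasure A m) (hE : E ∈ A) (hF : F ∈ A) :
    m (E ∩ F) + m (E \ F) = m E := by
  rw [← hm.add _ (A.inter_mem hE hF) _ (A.diff_mem hE hF) Set.disjoint_sdiff_inter.symm,
    Set.inter_union_sdiff]

theorem mono (hm : IsFinAddMeasure A m) (hE : E ∈ A) (hF : F ∈ A) (h : E ⊆ F) : m E ≤ m F := by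
  have h1 := hm.inter_add_diff hF hE
  rw [Set.inter_eq_right.2 h] at h1
  linarith [hm.nonneg _ (A.diff_mem hF hE)]

theorem add_compl (hm : IsFinAddMeasure A m) (hE : E ∈ A) : m E + m Eᶜ = m Set.univ := by
  have := hm.inter_add_diff A.univ_mem hE
  rwa [Set.univ_inter, ← Set.compl_eq_univ_sdiff] at this

theorem le_univ (hm : IsFinAddMeasure A m) (hE : E ∈ A) : m E ≤ m Set.univ :=
  hm.mono hE A.univ_mem (Set.subset_univ _)

theorem eq_zero_of_subset (hm : IsFinAddMeasure A m) (hE : E ∈ A) (hF : F ∈ A) (h : E ⊆ F)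
    (h0 : m F = 0) : m E = 0 :=
  le_antisymm (h0 ▸ hm.mono hE hF h) (hm.nonneg _ hE)

theorem inter_eq_of_full (hm : IsFinAddMeasure A m) (hE : E ∈ A) (hF : F ∈ A)
    (h : m F = m Set.univ) : m (E ∩ F) = m E := by
  have h1 : m Fᶜ = 0 := by linarith [hm.add_compl hF]
  have h2 := hm.inter_add_diff hE hF
  rw [hm.eq_zero_of_subset (A.diff_mem hE hF) (A.setCompl_mem hF) (fun _ h => h.2) h1] at h2
  linarith

theorem biUnion (hm : IsFinAddMeasure A m) {α : Type*} (s : Finset α) (X : α → Set Ω)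
    (h : ∀ a ∈ s, X a ∈ A) (hd : (s : Set α).PairwiseDisjoint X) :
    m (⋃ a ∈ s, X a) = ∑ a ∈ s, m (X a) := by
  classical
  induction s using Finset.induction_on with
  | empty => simpa using hm.empty
  | insert a s ha ih =>
    have h' : ∀ b ∈ s, X b ∈ A := fun b hb => h b (by simp [hb])
    rw [Finset.set_biUnion_insert, Finset.sum_insert ha,
      hm.add _ (h a (by simp)) _ (A.biUnion_mem s X h'),
      ih h' (hd.subset (by simp))]
    rw [Set.disjoint_iUnion₂_right]
    intro b hb
    exact hd (by simp) (by simp [hb]) (by rintro rfl; exact ha hb)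

theorem zero : IsFinAddMeasure A (fun _ => 0) := ⟨by simp, by simp⟩

theorem add_measure (hm : IsFinAddMeasure A m) (hm' : IsFinAddMeasure A m') :
    IsFinAddMeasure A (fun E => m E + m' E) :=
  ⟨fun E hE => add_nonneg (hm.nonneg E hE) (hm'.nonneg E hE), fun E hE F hF h => by
    simp only [hm.add E hE F hF h, hm'.add E hE F hF h]; ring⟩

theorem const_mul (hm : IsFinAddMeasure A m) {c : ℝ} (hc : 0 ≤ c) :
    IsFinAddMeasure A (fun E => c * m E) :=
  ⟨fun E hE => mul_nonneg hc (hm.nonneg E hE), fun E hE F hF h => by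
    simp only [hm.add E hE F hF h]; ring⟩

theorem finset_sum {α : Type*} (s : Finset α) {m : α → Set Ω → ℝ}
    (hm : ∀ a ∈ s, IsFinAddMeasure A (m a)) : IsFinAddMeasure A (fun E => ∑ a ∈ s, m a E) :=
  ⟨fun E hE => Finset.sum_nonneg fun a ha => (hm a ha).nonneg E hE, fun E hE F hF h => by
    rw [← Finset.sum_add_distrib]
    exact Finset.sum_congr rfl fun a ha => (hm a ha).add E hE F hF h⟩

end IsFinAddMeasure

/-- The point mass at `ω`. -/
noncomputable def pointMass (ω : Ω) (E : Set Ω) : ℝ := E.indicator (fun _ => (1 : ℝ)) ω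

theorem pointMass_of_mem {ω : Ω} (h : ω ∈ E) : pointMass ω E = 1 := Set.indicator_of_mem h _

theorem pointMass_of_notMem {ω : Ω} (h : ω ∉ E) : pointMass ω E = 0 :=
  Set.indicator_of_notMem h _

theorem pointMass_nonneg (ω : Ω) (E : Set Ω) : 0 ≤ pointMass ω E :=
  Set.indicator_nonneg (by simp) _

theorem pointMass_le_one (ω : Ω) (E : Set Ω) : pointMass ω E ≤ 1 :=
  Set.indicator_le_self' (by simp) _

theorem isFinAddProb_pointMass (ω : Ω) : IsFinAddProb A (pointMass ω) where
  nonneg E _ := pointMass_nonneg ω E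
  univ_eq := pointMass_of_mem (Set.mem_univ _)
  add E _ F _ h := by
    simp only [pointMass]
    rw [Set.indicator_union_of_disjoint h]

/-- The set of points that, among the events of `T`, lie exactly in those belonging to `c`. -/
def atomOf (T c : Finset (Set Ω)) : Set Ω := {ω | ∀ B ∈ T, ω ∈ B ↔ B ∈ c}

theorem atomOf_mem {T : Finset (Set Ω)} (hT : ∀ B ∈ T, B ∈ A) (c : Finset (Set Ω)) :
    atomOf T c ∈ A := by
  classical
  induction T using Finset.induction_on with
  | empty => simpa [atomOf] using A.univ_mem
  | insert B T hB ih =>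
    have h : atomOf (insert B T) c = (if B ∈ c then B else Bᶜ) ∩ atomOf T c := by
      ext ω
      by_cases hc : B ∈ c <;> simp [atomOf, hc]
    rw [h]
    refine A.inter_mem ?_ (ih fun X hX => hT X (by simp [hX]))
    split_ifs
    · exact hT B (by simp)
    · exact A.setCompl_mem (hT B (by simp))

theorem atomOf_subset_or_disjoint {T c : Finset (Set Ω)} {B : Set Ω} (hB : B ∈ T) :
    atomOf T c ⊆ B ∨ Disjoint (atomOf T c) B := by
  by_cases h : B ∈ c
  · exact Or.inl fun ω hω => (hω B hB).2 h
  · exact Or.inr (Set.disjoint_left.2 fun ω hω hωB => h ((hω B hB).1 hωB))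

/-- The atoms indexed by the subsets of `T` are pairwise disjoint and cover the space: a point lies
in the atom of those events of `T` that contain it. Empty atoms are harmless. -/
theorem IsFinAddMeasure.sum_inter_atomOf {m : Set Ω → ℝ} (hm : IsFinAddMeasure A m)
    {T : Finset (Set Ω)} (hT : ∀ B ∈ T, B ∈ A) (hF : F ∈ A) :
    ∑ c ∈ T.powerset, m (F ∩ atomOf T c) = m F := by
  classical
  rw [← hm.biUnion T.powerset (fun c => F ∩ atomOf T c)
    fun c _ => A.inter_mem hF (atomOf_mem hT c)]
  · congr 1
    ext ω
    simp only [Set.mem_iUnion, Set.mem_inter_iff, exists_and_left, exists_prop,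
      and_iff_left_iff_imp]
    intro _
    exact ⟨T.filter (ω ∈ ·), by simp, fun B hB => by simp [hB]⟩
  · intro c hc d hd hcd
    refine Set.disjoint_left.2 fun ω hω hω' => hcd ?_
    simp only [Finset.coe_powerset, Set.mem_preimage, Set.mem_powerset_iff,
      Finset.coe_subset] at hc hd
    ext B
    constructor
    · intro h
      exact (hω'.2 B (hc h)).1 ((hω.2 B (hc h)).2 h)
    · intro h
      exact (hω.2 B (hd h)).1 ((hω'.2 B (hd h)).2 h)

/-- A finite combination of indicators that is positive on an event of full probability has
positive expectation. -/
theorem IsFinAddProb.sum_pos {p : Set Ω → ℝ} (hp : IsFinAddProb A p) {α : Type*}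
    (s : Finset α) (X : α → Set Ω) (hX : ∀ a ∈ s, X a ∈ A) (r : α → ℝ) {U : Set Ω} (hU : U ∈ A)
    (hpU : p U = 1) (hpos : ∀ ω ∈ U, 0 < ∑ a ∈ s, r a * pointMass ω (X a)) :
    0 < ∑ a ∈ s, r a * p (X a) := by
  classical
  have hm := hp.toMeasure
  set T : Finset (Set Ω) := s.image X with hTdef
  have hT : ∀ B ∈ T, B ∈ A := by
    intro B hB
    obtain ⟨a, ha, rfl⟩ := Finset.mem_image.1 hB
    exact hX a ha
  have hXT : ∀ a ∈ s, X a ∈ T := fun a ha => Finset.mem_image_of_mem X ha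
  have h1 : ∑ a ∈ s, r a * p (X a) =
      ∑ c ∈ T.powerset, ∑ a ∈ s, r a * p (X a ∩ atomOf T c) := by
    rw [Finset.sum_comm]
    refine Finset.sum_congr rfl fun a ha => ?_
    rw [← Finset.mul_sum, hm.sum_inter_atomOf hT (hX a ha)]
  have hnull : ∀ c, ¬ (U ∩ atomOf T c).Nonempty → p (atomOf T c) = 0 := by
    intro c hc
    have h2 := hm.inter_eq_of_full (atomOf_mem hT c) hU (hpU.trans hp.univ_eq.symm)
    rw [Set.inter_comm, Set.not_nonempty_iff_eq_empty.1 hc, hm.empty] at h2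
    exact h2.symm
  -- The combination of indicators is constant on an atom, so its integral there is the mass of the
  -- atom times the value at any of its points, in particular at a point of `U`.
  have hterm : ∀ c, ∀ ω ∈ U ∩ atomOf T c, ∑ a ∈ s, r a * p (X a ∩ atomOf T c) =
      p (atomOf T c) * ∑ a ∈ s, r a * pointMass ω (X a) := by
    intro c ω hω
    rw [Finset.mul_sum]
    refine Finset.sum_congr rfl fun a ha => ?_
    by_cases h : ω ∈ X a
    · have hsub : atomOf T c ⊆ X a :=
        (atomOf_subset_or_disjoint (hXT a ha)).resolve_right fun hd =>
          Set.disjoint_left.1 hd hω.2 h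
      rw [Set.inter_eq_right.2 hsub, pointMass_of_mem h]
      ring
    · have hd : Disjoint (atomOf T c) (X a) :=
        (atomOf_subset_or_disjoint (hXT a ha)).resolve_left fun hs => h (hs hω.2)
      rw [Set.inter_comm, Set.disjoint_iff_inter_eq_empty.1 hd, hm.empty, pointMass_of_notMem h]
      ring
  have hzero : ∀ c, p (atomOf T c) = 0 → ∑ a ∈ s, r a * p (X a ∩ atomOf T c) = 0 := by
    intro c hc
    refine Finset.sum_eq_zero fun a ha => ?_
    rw [hm.eq_zero_of_subset (A.inter_mem (hX a ha) (atomOf_mem hT c)) (atomOf_mem hT c)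
      Set.inter_subset_right hc, mul_zero]
  rw [h1]
  refine Finset.sum_pos' (fun c _ => ?_) ?_
  · by_cases hc : (U ∩ atomOf T c).Nonempty
    · obtain ⟨ω, hω⟩ := hc
      rw [hterm c ω hω]
      exact mul_nonneg (hm.nonneg _ (atomOf_mem hT c)) (hpos ω hω.1).le
    · exact (hzero c (hnull c hc)).ge
  · have hone : ∑ c ∈ T.powerset, p (atomOf T c) = 1 := by
      have := hm.sum_inter_atomOf hT A.univ_mem
      simpa [hp.univ_eq] using this
    obtain ⟨c, hc, hne⟩ : ∃ c ∈ T.powerset, p (atomOf T c) ≠ 0 := by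
      by_contra! h
      rw [Finset.sum_eq_zero h] at hone
      exact zero_ne_one hone
    refine ⟨c, hc, ?_⟩
    obtain ⟨ω, hω⟩ : (U ∩ atomOf T c).Nonempty := by
      by_contra h
      exact hne (hnull c h)
    rw [hterm c ω hω]
    exact mul_pos (lt_of_le_of_ne (hm.nonneg _ (atomOf_mem hT c)) hne.symm) (hpos ω hω.1)

end FinAdd

/-! ### Joint probabilities: coherence as disintegration, and simultaneous minimisation along a
chain. -/

section Joint

variable {Ω ι : Type*} {A AL : BooleanSubalgebra (Set Ω)} {H : ι → Set Ω}
  {π : Set Ω → ℝ} {σ : Set Ω → Set Ω → ℝ}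

theorem gain_neg (P : Set Ω → Set Ω → ℝ) {n : ℕ} (e : Fin n → Set Ω × Set Ω) (s : Fin n → ℝ)
    (ω : Ω) : gain P e (fun j => - s j) ω = - gain P e s ω := by
  simp [gain]

/-- Puts the gain in the form required by `IsFinAddProb.sum_pos`: each bet splits into an indicator
of `E ∩ H` and one of `H`. -/
theorem gain_eq_sum_pointMass (P : Set Ω → Set Ω → ℝ) {n : ℕ} (e : Fin n → Set Ω × Set Ω)
    (s : Fin n → ℝ) (ω : Ω) :
    gain P e s ω = ∑ a : Fin n ⊕ Fin n,
      Sum.elim s (fun j => - s j * P (e j).1 (e j).2) a *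
        pointMass ω (Sum.elim (fun j => (e j).1 ∩ (e j).2) (fun j => (e j).2) a) := by
  rw [Fintype.sum_sum_type, ← Finset.sum_add_distrib]
  refine Finset.sum_congr rfl fun j _ => ?_
  have h : pointMass ω ((e j).1 ∩ (e j).2) = pointMass ω (e j).1 * pointMass ω (e j).2 := by
    by_cases h1 : ω ∈ (e j).1 <;> by_cases h2 : ω ∈ (e j).2 <;> simp [pointMass, h1, h2]
  simp only [Sum.elim_inl, Sum.elim_inr, h]
  simp only [pointMass]
  ring

/-- Gains whose expectation vanishes are not uniformly positive. -/
theorem exists_gain_nonpos {m : Set Ω → ℝ} (hm : IsFinAddProb A m) (P : Set Ω → Set Ω → ℝ)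
    {n : ℕ} (e : Fin n → Set Ω × Set Ω) (s : Fin n → ℝ) (he : ∀ j, (e j).1 ∈ A)
    (he' : ∀ j, (e j).2 ∈ A) {k : Fin n} (hk : m (e k).2 = 1)
    (h : ∀ j, m ((e j).1 ∩ (e j).2) = P (e j).1 (e j).2 * m (e j).2) :
    ∃ ω ∈ ⋃ j, (e j).2, gain P e s ω ≤ 0 := by
  by_contra! hcon
  have := hm.sum_pos Finset.univ (Sum.elim (fun j => (e j).1 ∩ (e j).2) (fun j => (e j).2))
    (by
      rintro (j | j) _
      · exact A.inter_mem (he j) (he' j)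
      · exact he' j)
    (Sum.elim s (fun j => - s j * P (e j).1 (e j).2)) (he' k) hk (fun ω hω => by
      rw [← gain_eq_sum_pointMass]
      exact hcon ω (Set.mem_iUnion.2 ⟨k, hω⟩))
  rw [Fintype.sum_sum_type, ← Finset.sum_add_distrib, Finset.sum_eq_zero] at this
  · exact lt_irrefl _ this
  · intro j _
    simp only [Sum.elim_inl, Sum.elim_inr, h]
    ring

/-- `H` is a partition of the sure event into nonempty events of the subalgebra `AL` of `A`,
such that each event of `AL` is a union of some of the `H i`. -/
structure IsAtomicPartition (A AL : BooleanSubalgebra (Set Ω)) (H : ι → Set Ω) : Prop where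
  le : AL ≤ A
  mem : ∀ i, H i ∈ AL
  nonempty : ∀ i, (H i).Nonempty
  disjoint : Pairwise fun i j => Disjoint (H i) (H j)
  cover : ∀ ω, ∃ i, ω ∈ H i
  subset_or_disjoint : ∀ B ∈ AL, ∀ i, H i ⊆ B ∨ Disjoint (H i) B

namespace IsAtomicPartition

theorem mem' (hH : IsAtomicPartition A AL H) (i : ι) : H i ∈ A := hH.le (hH.mem i)

theorem eq_of_mem (hH : IsAtomicPartition A AL H) {i j : ι} {ω : Ω} (hi : ω ∈ H i)
    (hj : ω ∈ H j) : i = j := by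
  by_contra h
  exact Set.disjoint_left.1 (hH.disjoint h) hi hj

theorem injective (hH : IsAtomicPartition A AL H) : Function.Injective H := by
  intro i j h
  obtain ⟨ω, hω⟩ := hH.nonempty i
  exact hH.eq_of_mem hω (h ▸ hω)

end IsAtomicPartition

theorem IsStrategy.self (hσ : IsStrategy A H σ) (hH : IsAtomicPartition A AL H) (i : ι) :
    σ (H i) (H i) = 1 :=
  hσ.eq_one i _ (hH.mem' i) (Set.inter_self _)

theorem IsStrategy.measure (hσ : IsStrategy A H σ) (i : ι) :
    IsFinAddMeasure A (fun F => σ F (H i)) := (hσ.finAdd i).toMeasure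

theorem IsStrategy.inter_self (hσ : IsStrategy A H σ) (hH : IsAtomicPartition A AL H) {F : Set Ω}
    (hF : F ∈ A) (i : ι) : σ (F ∩ H i) (H i) = σ F (H i) :=
  (hσ.measure i).inter_eq_of_full hF (hH.mem' i)
    ((hσ.self hH i).trans (hσ.finAdd i).univ_eq.symm)

theorem IsStrategy.le_one (hσ : IsStrategy A H σ) {F : Set Ω} (hF : F ∈ A) (i : ι) :
    σ F (H i) ≤ 1 :=
  (hσ.finAdd i).univ_eq ▸ (hσ.measure i).le_univ hF

theorem IsStrategy.eq_zero_of_disjoint (hσ : IsStrategy A H σ) (hH : IsAtomicPartition A AL H)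
    {F : Set Ω} (hF : F ∈ A) {i : ι} (h : Disjoint F (H i)) : σ F (H i) = 0 := by
  rw [← hσ.inter_self hH hF, Set.disjoint_iff_inter_eq_empty.1 h]
  exact (hσ.measure i).empty

/-- `p` is a finitely additive probability on `A` that extends `π` and disintegrates along each
`H i` according to `σ`. -/
structure IsJoint (A AL : BooleanSubalgebra (Set Ω)) (H : ι → Set Ω)
    (π : Set Ω → ℝ) (σ : Set Ω → Set Ω → ℝ) (p : Set Ω → ℝ) : Prop where
  finAdd : IsFinAddProb A p
  restrict : ∀ B ∈ AL, p B = π B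
  inter : ∀ F ∈ A, ∀ i, p (F ∩ H i) = σ F (H i) * π (H i)

theorem IsJoint.of_mem_jointProbs (hH : IsAtomicPartition A AL H) {p : Set Ω → ℝ}
    (hp : p ∈ jointProbs A AL H π σ) : IsJoint A AL H π σ p := by
  obtain ⟨h1, h2, Q, hQ1, hQ2, hQ⟩ := hp
  refine ⟨h1, h2, fun F hF i => ?_⟩
  have hFi := A.inter_mem hF (hH.mem' i)
  -- With these stakes the random parts of the three bets cancel, so the gain is constant, and
  -- coherence forces the constant to be zero.
  have hg : ∀ ω, gain Q ![(F ∩ H i, Set.univ), (H i, Set.univ), (F, H i)]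
      ![1, - σ F (H i), -1] ω = σ F (H i) * p (H i) - p (F ∩ H i) := by
    intro ω
    simp only [gain, Fin.sum_univ_three, Matrix.cons_val_zero, Matrix.cons_val_one,
      Matrix.cons_val, hQ1 _ hFi, hQ1 _ (hH.mem' i), hQ2 F hF i]
    by_cases h3 : ω ∈ H i <;> by_cases h4 : ω ∈ F <;> simp [h3, h4] <;> ring
  obtain ⟨⟨ω, _, hω⟩, ⟨ω', _, hω'⟩⟩ := hQ.gain_bounds 3 (by norm_num)
    ![(F ∩ H i, Set.univ), (H i, Set.univ), (F, H i)] ![1, - σ F (H i), -1] (by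
      intro j
      fin_cases j
      · exact ⟨hFi, Or.inl rfl⟩
      · exact ⟨hH.mem' i, Or.inl rfl⟩
      · exact ⟨hF, Or.inr ⟨i, rfl⟩⟩)
  rw [hg] at hω hω'
  rw [h2 _ (hH.mem i)] at hω hω'
  linarith

theorem IsJoint.mem_jointProbs (hH : IsAtomicPartition A AL H) (hσ : IsStrategy A H σ)
    {p : Set Ω → ℝ} (hp : IsJoint A AL H π σ p) : p ∈ jointProbs A AL H π σ := by
  classical
  have hΩ : (Set.univ : Set Ω).Nonempty := by
    by_contra h
    have h1 := hp.finAdd.univ_eq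
    rw [Set.not_nonempty_iff_eq_empty.1 h, hp.finAdd.toMeasure.empty] at h1
    exact zero_ne_one h1
  -- If the partition is trivial, `H i` is the sure event and `p` and `σ` both prescribe values
  -- there; they agree, so the definition of `Q` by cases is consistent.
  have huniv : ∀ i, H i = Set.univ → ∀ F ∈ A, p F = σ F (H i) := by
    intro i hi F hF
    have h1 := hp.inter F hF i
    rwa [← hp.restrict _ (hH.mem i), hi, hp.finAdd.univ_eq, Set.inter_univ, mul_one, ← hi] at h1
  set Q : Set Ω → Set Ω → ℝ := fun F K => if K = Set.univ then p F else σ F K with hQ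
  have hQ1 : ∀ F, Q F Set.univ = p F := fun F => if_pos rfl
  have hQ2 : ∀ F ∈ A, ∀ i, Q F (H i) = σ F (H i) := by
    intro F hF i
    by_cases h : H i = Set.univ
    · rw [h, hQ1, ← h, huniv i h F hF]
    · exact if_neg h
  refine ⟨hp.finAdd, hp.restrict, Q, fun F _ => hQ1 F, hQ2, ?_, ?_, ?_⟩
  · rintro ⟨F, K⟩ ⟨_, rfl | ⟨i, rfl⟩⟩
    · exact hΩ
    · exact hH.nonempty i
  · rintro ⟨F, K⟩ ⟨hF, rfl | ⟨i, rfl⟩⟩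
    · simp only [hQ1]
      exact ⟨hp.finAdd.nonneg F hF, hp.finAdd.univ_eq ▸ hp.finAdd.toMeasure.le_univ hF⟩
    · simp only [hQ2 F hF i]
      exact ⟨(hσ.measure i).nonneg F hF, hσ.le_one hF i⟩
  · intro n hn e s he
    have he1 : ∀ j, (e j).1 ∈ A := fun j => (he j).1
    have he2 : ∀ j, (e j).2 ∈ A := by
      intro j
      rcases (he j).2 with h | ⟨i, hi⟩
      · rw [Set.mem_singleton_iff.1 h]
        exact A.univ_mem
      · rw [← hi]
        exact hH.mem' i
    -- The probability making all bets fair: `p` if some bet is unconditional. Otherwise `σ(·|H i)`,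
    -- with `H i` the conditioning event of the first bet; bets conditional on any other cell are
    -- called off with probability one.
    obtain ⟨m, hm, k, hk, hmk⟩ : ∃ m, IsFinAddProb A m ∧ ∃ k, m (e k).2 = 1 ∧
        ∀ j, m ((e j).1 ∩ (e j).2) = Q (e j).1 (e j).2 * m (e j).2 := by
      by_cases hu : ∃ k, (e k).2 = Set.univ
      · obtain ⟨k, hk⟩ := hu
        refine ⟨p, hp.finAdd, k, by rw [hk, hp.finAdd.univ_eq], fun j => ?_⟩
        rcases (he j).2 with h | ⟨i, hi⟩
        · rw [Set.mem_singleton_iff.1 h, hQ1, Set.inter_univ, hp.finAdd.univ_eq, mul_one]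
        · rw [← hi, hQ2 _ (he1 j), hp.inter _ (he1 j), hp.restrict _ (hH.mem i)]
      · push Not at hu
        have hi : ∀ j, ∃ i, H i = (e j).2 := fun j =>
          (he j).2.resolve_left fun h => hu j h
        obtain ⟨i, hik⟩ := hi ⟨0, hn⟩
        refine ⟨fun F => σ F (H i), hσ.finAdd i, ⟨0, hn⟩, ?_, fun j => ?_⟩
        · rw [← hik]
          exact hσ.self hH i
        · obtain ⟨i', hi'⟩ := hi j
          rw [← hi', hQ2 _ (he1 j)]
          beta_reduce
          by_cases hii : i' = i
          · subst hii
            rw [hσ.inter_self hH (he1 j), hσ.self hH, mul_one]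
          · rw [hσ.eq_zero_of_disjoint hH (A.inter_mem (he1 j) (hH.mem' i'))
                ((hH.disjoint hii).mono_left Set.inter_subset_right),
              hσ.eq_zero_of_disjoint hH (hH.mem' i') (hH.disjoint hii), mul_zero]
    refine ⟨exists_gain_nonpos hm Q e s he1 he2 hk hmk, ?_⟩
    obtain ⟨ω, h1, h2⟩ := exists_gain_nonpos hm Q e (fun j => - s j) he1 he2 hk hmk
    rw [gain_neg] at h2
    exact ⟨ω, h1, by linarith⟩

open Filter in
theorem Ultrafilter.exists_tendsto_of_mem_Icc {D : Type*} (U : Ultrafilter D) {f : D → ℝ}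
    {a b : ℝ} (h : ∀ᶠ d in (U : Filter D), f d ∈ Set.Icc a b) :
    ∃ x, Filter.Tendsto f U (nhds x) := by
  obtain ⟨x, _, hx⟩ := (isCompact_Icc (a := a) (b := b)).ultrafilter_le_nhds (U.map f)
    (le_principal_iff.2 h)
  exact ⟨x, hx⟩

open Filter Topology in
/-- A single joint probability gives the events of a chain `S ⊆ S'` their minimal values. -/
theorem exists_isJoint_le (hH : IsAtomicPartition A AL H) (hσ : IsStrategy A H σ)
    (hπ : IsFinAddProb AL π) {S S' : Set Ω} (hS : S ∈ A) (hS' : S' ∈ A) (hSS : S ⊆ S') :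
    ∃ p, IsJoint A AL H π σ p ∧ ∀ q, IsJoint A AL H π σ q → p S ≤ q S ∧ p S' ≤ q S' := by
  classical
  have hπm := hπ.toMeasure
  -- A measure of mass `π C` carried by `C`, which follows `σ` when `C` is a cell of the partition
  -- and gives `S` and `S'` no more than any joint probability gives to their traces on `C`.
  have hκ : ∀ C : Set Ω, ∃ κ : Set Ω → ℝ, C ∈ AL → IsFinAddMeasure A κ ∧ κ Set.univ = π C ∧
      κ C = π C ∧ (∀ i, C = H i → ∀ F ∈ A, κ F = σ F (H i) * π (H i)) ∧
      ∀ q, IsJoint A AL H π σ q → κ S ≤ q (S ∩ C) ∧ κ S' ≤ q (S' ∩ C) := by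
    intro C
    by_cases hC : C ∈ AL
    swap
    · exact ⟨0, fun h => absurd h hC⟩
    by_cases hi : ∃ i, C = H i
    · obtain ⟨i, rfl⟩ := hi
      refine ⟨fun F => π (H i) * σ F (H i), fun _ =>
        ⟨(hσ.measure i).const_mul (hπ.nonneg _ hC), ?_, ?_, ?_, ?_⟩⟩
      · simp [(hσ.finAdd i).univ_eq]
      · simp [hσ.self hH i]
      · intro j hj F _
        obtain rfl := hH.injective hj
        ring
      · intro q hq
        rw [hq.inter _ hS, hq.inter _ hS']
        exact ⟨by rw [mul_comm], by rw [mul_comm]⟩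
    · by_cases hne : C.Nonempty
      swap
      · obtain rfl := Set.not_nonempty_iff_eq_empty.1 hne
        refine ⟨fun _ => 0, fun _ => ⟨.zero, hπm.empty.symm, hπm.empty.symm, ?_, ?_⟩⟩
        · exact fun i h => absurd ⟨i, h⟩ hi
        · intro q hq
          simp [hq.finAdd.toMeasure.empty]
      -- Because `S ⊆ S'`, a point of `C` outside `S'` avoids both events. If there is none, a point
      -- outside `S` suffices, as `C ⊆ S'` already forces full mass on `S'`.
      obtain ⟨ω, hω, hωS, hωS'⟩ : ∃ ω ∈ C, (ω ∈ S → C ⊆ S) ∧ (ω ∈ S' → C ⊆ S') := by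
        by_cases h1 : C ⊆ S
        · obtain ⟨ω, hω⟩ := hne
          exact ⟨ω, hω, fun _ => h1, fun _ => h1.trans hSS⟩
        by_cases h2 : C ⊆ S'
        · obtain ⟨ω, hω, hωS⟩ := Set.not_subset.1 h1
          exact ⟨ω, hω, fun h => absurd h hωS, fun _ => h2⟩
        · obtain ⟨ω, hω, hωS⟩ := Set.not_subset.1 h2
          exact ⟨ω, hω, fun h => absurd (hSS h) hωS, fun h => absurd h hωS⟩
      have key : ∀ q, IsJoint A AL H π σ q → ∀ X ∈ A, (ω ∈ X → C ⊆ X) →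
          π C * pointMass ω X ≤ q (X ∩ C) := by
        intro q hq X hX h
        by_cases hωX : ω ∈ X
        · rw [pointMass_of_mem hωX, Set.inter_eq_right.2 (h hωX), hq.restrict _ hC, mul_one]
        · rw [pointMass_of_notMem hωX, mul_zero]
          exact hq.finAdd.nonneg _ (A.inter_mem hX (hH.le hC))
      refine ⟨fun F => π C * pointMass ω F, fun _ =>
        ⟨(isFinAddProb_pointMass ω).toMeasure.const_mul (hπ.nonneg _ hC), ?_, ?_, ?_, ?_⟩⟩
      · simp [pointMass_of_mem (Set.mem_univ ω)]
      · simp [pointMass_of_mem hω]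
      · exact fun i h => absurd ⟨i, h⟩ hi
      · exact fun q hq => ⟨key q hq S hS hωS, key q hq S' hS' hωS'⟩
  choose κ hκ using hκ
  -- Filtering by `AL` lets the net run over all finite families of sets, a directed order, while
  -- using only events that `π` measures.
  let T : Finset (Set Ω) → Finset (Set Ω) := fun T₀ => T₀.filter (· ∈ AL)
  have hT : ∀ T₀, ∀ B ∈ T T₀, B ∈ AL := fun T₀ B hB => (Finset.mem_filter.1 hB).2
  have hTA : ∀ T₀, ∀ B ∈ T T₀, B ∈ A := fun T₀ B hB => hH.le (hT T₀ B hB)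
  have hat : ∀ T₀ c, atomOf (T T₀) c ∈ AL := fun T₀ c => atomOf_mem (hT T₀) c
  let P : Finset (Set Ω) → Set Ω → ℝ := fun T₀ F =>
    ∑ c ∈ (T T₀).powerset, κ (atomOf (T T₀) c) F
  have hPm : ∀ T₀, IsFinAddMeasure A (P T₀) := fun T₀ =>
    .finset_sum _ fun c _ => (hκ _ (hat T₀ c)).1
  have hPuniv : ∀ T₀, P T₀ Set.univ = 1 := by
    intro T₀
    have h1 := hπm.sum_inter_atomOf (hT T₀) AL.univ_mem
    rw [hπ.univ_eq] at h1
    rw [← h1]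
    refine Finset.sum_congr rfl fun c _ => ?_
    rw [(hκ _ (hat T₀ c)).2.1, Set.univ_inter]
  have hκ0 : ∀ C ∈ AL, ∀ B ∈ A, Disjoint C B → κ C B = 0 := by
    intro C hC B hB hd
    obtain ⟨h1, h2, h3, _⟩ := hκ C hC
    refine h1.eq_zero_of_subset hB (A.setCompl_mem (hH.le hC)) hd.subset_compl_left ?_
    linarith [h1.add_compl (hH.le hC)]
  have hPB : ∀ T₀, ∀ B ∈ T T₀, P T₀ B = π B := by
    intro T₀ B hB
    rw [← hπm.sum_inter_atomOf (hT T₀) (hT T₀ B hB)]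
    refine Finset.sum_congr rfl fun c _ => ?_
    rcases atomOf_subset_or_disjoint (c := c) hB with h | h
    · obtain ⟨h1, h2, h3, _⟩ := hκ _ (hat T₀ c)
      rw [Set.inter_eq_right.2 h]
      refine le_antisymm (h2 ▸ h1.le_univ (hTA T₀ B hB)) ?_
      rw [← h3]
      exact h1.mono (hH.le (hat T₀ c)) (hTA T₀ B hB) h
    · rw [hκ0 _ (hat T₀ c) _ (hTA T₀ B hB) h, Set.inter_comm,
        Set.disjoint_iff_inter_eq_empty.1 h, hπm.empty]
  have hPH : ∀ T₀ i, H i ∈ T T₀ → ∀ F ∈ A, P T₀ (F ∩ H i) = σ F (H i) * π (H i) := by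
    intro T₀ i hi F hF
    rw [← hπm.sum_inter_atomOf (hT T₀) (hH.mem i), Finset.mul_sum]
    refine Finset.sum_congr rfl fun c _ => ?_
    -- No event of `AL` cuts `H i`, so once `H i` belongs to the family it is itself an atom and its
    -- mass is spread according to `σ`.
    have hcase : atomOf (T T₀) c = H i ∨ Disjoint (atomOf (T T₀) c) (H i) := by
      rcases hH.subset_or_disjoint _ (hat T₀ c) i with h | h
      · rcases atomOf_subset_or_disjoint (c := c) hi with h' | h'
        · exact Or.inl (h'.antisymm h)
        · exact Or.inr h'
      · exact Or.inr h.symm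
    rcases hcase with h | h
    · rw [(hκ _ (hat T₀ c)).2.2.2.1 i h _ (A.inter_mem hF (hH.mem' i)), h, Set.inter_self,
        hσ.inter_self hH hF]
    · rw [hκ0 _ (hat T₀ c) _ (A.inter_mem hF (hH.mem' i)) (h.mono_right Set.inter_subset_right),
        Set.inter_comm, Set.disjoint_iff_inter_eq_empty.1 h, hπm.empty, mul_zero]
  have hPle : ∀ T₀ q, IsJoint A AL H π σ q → P T₀ S ≤ q S ∧ P T₀ S' ≤ q S' := by
    intro T₀ q hq
    have hqm := hq.finAdd.toMeasure
    rw [← hqm.sum_inter_atomOf (hTA T₀) hS, ← hqm.sum_inter_atomOf (hTA T₀) hS']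
    exact ⟨Finset.sum_le_sum fun c _ => ((hκ _ (hat T₀ c)).2.2.2.2 q hq).1,
      Finset.sum_le_sum fun c _ => ((hκ _ (hat T₀ c)).2.2.2.2 q hq).2⟩
  -- Each event of `AL` eventually belongs to the family, so the constraints at `B` and at `H i`,
  -- each valid only from some stage on, hold in the limit; the minimality bounds hold at every
  -- stage.
  let U : Ultrafilter (Finset (Set Ω)) := Ultrafilter.of atTop
  have hU : (U : Filter (Finset (Set Ω))) ≤ atTop := Ultrafilter.of_le atTop
  have hmem : ∀ B ∈ AL, ∀ᶠ T₀ in (U : Filter (Finset (Set Ω))), B ∈ T T₀ := by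
    intro B hB
    refine hU ?_
    filter_upwards [eventually_ge_atTop {B}] with T₀ h
    exact Finset.mem_filter.2 ⟨h (by simp), hB⟩
  have hlim : ∀ F, ∃ x, F ∈ A → Tendsto (fun T₀ => P T₀ F) U (𝓝 x) := by
    intro F
    by_cases hF : F ∈ A
    · obtain ⟨x, hx⟩ := U.exists_tendsto_of_mem_Icc (f := fun T₀ => P T₀ F) (a := 0) (b := 1)
        (.of_forall fun T₀ => ⟨(hPm T₀).nonneg F hF, hPuniv T₀ ▸ (hPm T₀).le_univ hF⟩)
      exact ⟨x, fun _ => hx⟩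
    · exact ⟨0, fun h => absurd h hF⟩
  choose p hp using hlim
  refine ⟨p, ⟨⟨fun F hF => ?_, ?_, fun E hE F hF hd => ?_⟩, fun B hB => ?_, fun F hF i => ?_⟩,
    fun q hq => ⟨?_, ?_⟩⟩
  · exact ge_of_tendsto' (hp F hF) fun T₀ => (hPm T₀).nonneg F hF
  · refine tendsto_nhds_unique (hp _ A.univ_mem) ?_
    simp only [hPuniv]
    exact tendsto_const_nhds
  · refine tendsto_nhds_unique (hp _ (A.union_mem hE hF)) ?_
    simp only [fun T₀ => (hPm T₀).add E hE F hF hd]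
    exact (hp E hE).add (hp F hF)
  · refine tendsto_nhds_unique (hp _ (hH.le hB)) (tendsto_const_nhds.congr' ?_)
    filter_upwards [hmem B hB] with T₀ h using (hPB T₀ B h).symm
  · refine tendsto_nhds_unique (hp _ (A.inter_mem hF (hH.mem' i))) (tendsto_const_nhds.congr' ?_)
    filter_upwards [hmem _ (hH.mem i)] with T₀ h using (hPH T₀ i h F hF).symm
  · exact le_of_tendsto' (hp S hS) fun T₀ => (hPle T₀ q hq).1
  · exact le_of_tendsto' (hp S' hS') fun T₀ => (hPle T₀ q hq).2

end Joint

/-! ### Full conditional probabilities as limits of layered measures. -/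

section Extension

open Filter Topology

variable {Ω ι : Type*} {A AL : BooleanSubalgebra (Set Ω)} {H : ι → Set Ω}
  {π : Set Ω → ℝ} {σ : Set Ω → Set Ω → ℝ}

/-- Ratios of eventually positive measures converge along an ultrafilter to a full conditional
probability. -/
theorem exists_isFullCondProb_tendsto {D : Type*} (U : Ultrafilter D) (μ : D → Set Ω → ℝ)
    (hμ : ∀ d, IsFinAddMeasure A (μ d))
    (hpos : ∀ K ∈ A, K.Nonempty → ∀ᶠ d in (U : Filter D), 0 < μ d K) :
    ∃ P, IsFullCondProb A P ∧ ∀ F ∈ A, ∀ K ∈ A, K.Nonempty →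
      Tendsto (fun d => μ d (F ∩ K) / μ d K) U (𝓝 (P F K)) := by
  have hlim : ∀ F K, ∃ x, F ∈ A → K ∈ A → K.Nonempty →
      Tendsto (fun d => μ d (F ∩ K) / μ d K) U (𝓝 x) := by
    intro F K
    by_cases h : F ∈ A ∧ K ∈ A ∧ K.Nonempty
    · obtain ⟨hF, hK, hKn⟩ := h
      obtain ⟨x, hx⟩ := U.exists_tendsto_of_mem_Icc (f := fun d => μ d (F ∩ K) / μ d K)
        (a := 0) (b := 1) (by
          filter_upwards [hpos K hK hKn] with d hd
          exact ⟨div_nonneg ((hμ d).nonneg _ (A.inter_mem hF hK)) hd.le,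
            (div_le_one hd).2 ((hμ d).mono (A.inter_mem hF hK) hK Set.inter_subset_right)⟩)
      exact ⟨x, fun _ _ _ => hx⟩
    · exact ⟨0, fun h1 h2 h3 => absurd ⟨h1, h2, h3⟩ h⟩
  choose P hP using hlim
  refine ⟨P, ⟨fun E hE K hK hKn => ?_, fun K hK hKn => ⟨fun E hE => ?_, ?_,
    fun E hE F hF hd => ?_⟩, fun E hE F hF K hK hKn hEK => ?_⟩,
    fun F hF K hK hKn => hP F K hF hK hKn⟩
  · refine tendsto_nhds_unique (hP E K hE hK hKn) ?_
    have h := hP (E ∩ K) K (A.inter_mem hE hK) hK hKn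
    simpa only [Set.inter_assoc, Set.inter_self] using h
  · refine ge_of_tendsto (hP E K hE hK hKn) ?_
    filter_upwards [hpos K hK hKn] with d hd
    exact div_nonneg ((hμ d).nonneg _ (A.inter_mem hE hK)) hd.le
  · refine tendsto_nhds_unique (hP _ K A.univ_mem hK hKn) (tendsto_const_nhds.congr' ?_)
    filter_upwards [hpos K hK hKn] with d hd
    rw [Set.univ_inter, div_self hd.ne']
  · refine tendsto_nhds_unique (hP _ K (A.union_mem hE hF) hK hKn) ?_
    refine ((hP E K hE hK hKn).add (hP F K hF hK hKn)).congr fun d => ?_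
    rw [Set.union_inter_distrib_right, (hμ d).add _ (A.inter_mem hE hK) _ (A.inter_mem hF hK)
      (hd.mono Set.inter_subset_left Set.inter_subset_left), add_div]
  · have hEK' := A.inter_mem hE hK
    refine tendsto_nhds_unique (hP _ K (A.inter_mem hE hF) hK hKn) ?_
    refine ((hP E K hE hK hKn).mul (hP F _ hF hEK' hEK)).congr' ?_
    filter_upwards [hpos _ hEK' hEK] with d hd
    rw [mul_comm, div_mul_div_cancel₀ hd.ne']
    congr 2
    ext ω
    simp only [Set.mem_inter_iff]
    tauto

/-- The finitely additive measure `m` follows the strategy on `H i` up to a relative error `ε`. -/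
def FollowsUpTo (A : BooleanSubalgebra (Set Ω)) (H : ι → Set Ω) (σ : Set Ω → Set Ω → ℝ) (ε : ℝ)
    (i : ι) (m : Set Ω → ℝ) : Prop :=
  ∀ F ∈ A, |m (F ∩ H i) - σ F (H i) * m (H i)| ≤ ε * m (H i)

namespace FollowsUpTo

variable {ε : ℝ} {i : ι} {m m' : Set Ω → ℝ}

theorem add_measure (h : FollowsUpTo A H σ ε i m) (h' : FollowsUpTo A H σ ε i m') :
    FollowsUpTo A H σ ε i (fun F => m F + m' F) := by
  intro F hF
  calc _ = |(m (F ∩ H i) - σ F (H i) * m (H i)) + (m' (F ∩ H i) - σ F (H i) * m' (H i))| := by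
        congr 1; ring
    _ ≤ ε * m (H i) + ε * m' (H i) := (abs_add_le _ _).trans (add_le_add (h F hF) (h' F hF))
    _ = _ := by ring

theorem const_mul (h : FollowsUpTo A H σ ε i m) {c : ℝ} (hc : 0 ≤ c) :
    FollowsUpTo A H σ ε i (fun F => c * m F) := by
  intro F hF
  calc _ = |c * (m (F ∩ H i) - σ F (H i) * m (H i))| := by congr 1; ring
    _ = c * |m (F ∩ H i) - σ F (H i) * m (H i)| := by rw [abs_mul, abs_of_nonneg hc]
    _ ≤ c * (ε * m (H i)) := mul_le_mul_of_nonneg_left (h F hF) hc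
    _ = _ := by ring

theorem finset_sum {α : Type*} (s : Finset α) {m : α → Set Ω → ℝ}
    (h : ∀ a ∈ s, FollowsUpTo A H σ ε i (m a)) :
    FollowsUpTo A H σ ε i (fun F => ∑ a ∈ s, m a F) := by
  intro F hF
  simp only [Finset.mul_sum, ← Finset.sum_sub_distrib]
  exact (Finset.abs_sum_le_sum_abs _ _).trans (Finset.sum_le_sum fun a ha => h a ha F hF)

/-- A measure that does not charge `H i` puts no constraint on the conditional probability there, so
it can be added as a layer. -/
theorem of_eq_zero (hm : IsFinAddMeasure A m) (hi : H i ∈ A) (h : m (H i) = 0) :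
    FollowsUpTo A H σ ε i m := by
  intro F hF
  rw [hm.eq_zero_of_subset (A.inter_mem hF hi) hi Set.inter_subset_right h, h]
  simp

end FollowsUpTo

theorem IsJoint.followsUpTo (hH : IsAtomicPartition A AL H) {p : Set Ω → ℝ}
    (hp : IsJoint A AL H π σ p) {ε : ℝ} (hε : 0 ≤ ε) (i : ι) : FollowsUpTo A H σ ε i p := by
  intro F hF
  rw [hp.inter F hF, hp.restrict _ (hH.mem i), sub_self, abs_zero, ← hp.restrict _ (hH.mem i)]
  exact mul_nonneg hε (hp.finAdd.nonneg _ (hH.mem' i))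

/-- The conditional probability given `H i`, slightly tilted towards the point `ω`. -/
noncomputable def tilt (H : ι → Set Ω) (σ : Set Ω → Set Ω → ℝ) (ε : ℝ) (i : ι) (ω : Ω)
    (F : Set Ω) : ℝ :=
  σ F (H i) + ε * pointMass ω F

section tilt

variable {ε : ℝ} {i : ι} {ω : Ω}

theorem isFinAddMeasure_tilt (hσ : IsStrategy A H σ) (hε : 0 ≤ ε) :
    IsFinAddMeasure A (tilt H σ ε i ω) :=
  (hσ.measure i).add_measure ((isFinAddProb_pointMass ω).toMeasure.const_mul hε)

theorem tilt_univ (hσ : IsStrategy A H σ) : tilt H σ ε i ω Set.univ = 1 + ε := by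
  rw [tilt, (hσ.finAdd i).univ_eq, pointMass_of_mem (Set.mem_univ ω), mul_one]

theorem le_tilt (hσ : IsStrategy A H σ) {K : Set Ω} (hK : K ∈ A) (hω : ω ∈ K) :
    ε ≤ tilt H σ ε i ω K := by
  rw [tilt, pointMass_of_mem hω, mul_one]
  linarith [(hσ.measure i).nonneg K hK]

/-- On its own cell the added point mass changes values by at most `ε`, and the cell has mass at
least one; the other cells are null. -/
theorem followsUpTo_tilt (hH : IsAtomicPartition A AL H) (hσ : IsStrategy A H σ) (hε : 0 ≤ ε)
    (hω : ω ∈ H i) (j : ι) : FollowsUpTo A H σ ε j (tilt H σ ε i ω) := by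
  by_cases hij : j = i
  · subst hij
    intro F hF
    have h0 := pointMass_nonneg ω (F ∩ H j)
    have h1 := pointMass_le_one ω (F ∩ H j)
    have h2 := (hσ.measure j).nonneg F hF
    have h3 := hσ.le_one hF j
    have h4 : |pointMass ω (F ∩ H j) - σ F (H j)| ≤ 1 := abs_le.2 ⟨by linarith, by linarith⟩
    calc _ = |ε * (pointMass ω (F ∩ H j) - σ F (H j))| := by
          rw [tilt, tilt, hσ.inter_self hH hF, hσ.self hH, pointMass_of_mem hω]
          congr 1; ring
      _ = ε * |pointMass ω (F ∩ H j) - σ F (H j)| := by rw [abs_mul, abs_of_nonneg hε]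
      _ ≤ ε * 1 := mul_le_mul_of_nonneg_left h4 hε
      _ ≤ ε * tilt H σ ε j ω (H j) := by
          refine mul_le_mul_of_nonneg_left ?_ hε
          rw [tilt, hσ.self hH]
          linarith [mul_nonneg hε (pointMass_nonneg ω (H j))]
  · refine .of_eq_zero (isFinAddMeasure_tilt hσ hε) (hH.mem' j) ?_
    rw [tilt, hσ.eq_zero_of_disjoint hH (hH.mem' j) (hH.disjoint hij),
      pointMass_of_notMem fun h => hij (hH.eq_of_mem h hω), mul_zero, add_zero]

end tilt

/-- The infinitesimal scale attached to a finite set of points and an integer. -/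
noncomputable def scale (d : Finset Ω × ℕ) : ℝ := 1 / ((d.2 + 1) * (d.1.card + 1))

theorem scale_pos (d : Finset Ω × ℕ) : 0 < scale d := by unfold scale; positivity

theorem scale_mul_card_le (d : Finset Ω × ℕ) : scale d * (d.1.card + 1) ≤ 1 / (d.2 + 1) := by
  unfold scale
  rw [← div_div, div_mul_cancel₀]
  positivity

theorem scale_le (d : Finset Ω × ℕ) : scale d ≤ 1 / (d.2 + 1) := by
  refine le_trans ?_ (scale_mul_card_le d)
  nlinarith [scale_pos d, Nat.cast_nonneg (α := ℝ) d.1.card]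

theorem scale_le_one (d : Finset Ω × ℕ) : scale d ≤ 1 := by
  refine (scale_le d).trans ?_
  rw [div_le_one (by positivity)]
  linarith [Nat.cast_nonneg (α := ℝ) d.2]

theorem tendsto_snd_inv :
    Tendsto (fun d : Finset Ω × ℕ => 1 / ((d.2 : ℝ) + 1)) (atTop ×ˢ atTop) (𝓝 0) :=
  tendsto_one_div_add_atTop_nhds_zero_nat.comp tendsto_snd

theorem tendsto_scale : Tendsto (scale (Ω := Ω)) (atTop ×ˢ atTop) (𝓝 0) :=
  squeeze_zero (fun d => (scale_pos d).le) scale_le tendsto_snd_inv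

/-- The measure `Σ_{ω ∈ s} (σ(·|H_{i(ω)}) + ε δ_ω)`, which charges all events meeting `s`. -/
noncomputable def fullSupport (H : ι → Set Ω) (σ : Set Ω → Set Ω → ℝ) (idx : Ω → ι)
    (d : Finset Ω × ℕ) (F : Set Ω) : ℝ :=
  ∑ ω ∈ d.1, tilt H σ (scale d) (idx ω) ω F

theorem isFinAddMeasure_fullSupport (hσ : IsStrategy A H σ) (idx : Ω → ι) (d : Finset Ω × ℕ) :
    IsFinAddMeasure A (fullSupport H σ idx d) :=
  .finset_sum _ fun _ _ => isFinAddMeasure_tilt hσ (scale_pos d).le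

/-- The reason for the factor `card + 1` in `scale`: the mass of `fullSupport` grows at most like
twice the number of points, and the scale absorbs it. -/
theorem scale_mul_fullSupport_le (hσ : IsStrategy A H σ) (idx : Ω → ι) (d : Finset Ω × ℕ)
    {F : Set Ω} (hF : F ∈ A) : scale d * fullSupport H σ idx d F ≤ 2 * (1 / (d.2 + 1)) := by
  have h1 : fullSupport H σ idx d F ≤ d.1.card * 2 := by
    refine ((isFinAddMeasure_fullSupport hσ idx d).le_univ hF).trans ?_
    rw [fullSupport, ← nsmul_eq_mul]
    refine Finset.sum_le_card_nsmul _ _ _ fun ω _ => ?_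
    rw [tilt_univ hσ]
    linarith [scale_le_one d]
  have h2 := mul_le_mul_of_nonneg_left h1 (scale_pos d).le
  nlinarith [scale_mul_card_le d, scale_pos d]

theorem tendsto_scale_mul_fullSupport (hσ : IsStrategy A H σ) (idx : Ω → ι) {F : Set Ω}
    (hF : F ∈ A) :
    Tendsto (fun d => scale d * fullSupport H σ idx d F) (atTop ×ˢ atTop) (𝓝 0) := by
  refine squeeze_zero (fun d => mul_nonneg (scale_pos d).le
    ((isFinAddMeasure_fullSupport hσ idx d).nonneg F hF))
    (fun d => scale_mul_fullSupport_le hσ idx d hF) ?_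
  simpa using tendsto_snd_inv.const_mul 2

/-- A joint probability `p` extends to a full conditional probability consistent with the
strategy, whose values given a `p`-null event are ruled by the next layers `m d`. -/
theorem exists_fullExtension (hH : IsAtomicPartition A AL H) (hσ : IsStrategy A H σ)
    {p : Set Ω → ℝ} (hp : IsJoint A AL H π σ p) (m : Finset Ω × ℕ → Set Ω → ℝ)
    (hm : ∀ d, IsFinAddMeasure A (m d)) (hm2 : ∀ d, m d Set.univ ≤ 2)
    (hfol : ∀ i, ∀ᶠ d in atTop ×ˢ atTop, FollowsUpTo A H σ (scale d) i (m d)) :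
    ∃ P ∈ fullExtensions A AL H π σ, (∀ F ∈ A, P F Set.univ = p F) ∧
      ∀ F ∈ A, ∀ K ∈ A, K.Nonempty → p K = 0 → (∀ d, scale d ≤ m d K) → ∀ r,
        Tendsto (fun d => m d (F ∩ K) / m d K) (atTop ×ˢ atTop) (𝓝 r) → P F K = r := by
  choose idx hidx using hH.cover
  set ρ := fullSupport H σ idx with hρdef
  have hρ : ∀ d, IsFinAddMeasure A (ρ d) := isFinAddMeasure_fullSupport hσ idx
  have hs : ∀ d : Finset Ω × ℕ, 0 ≤ scale d := fun d => (scale_pos d).le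
  -- Three layers: `p` decides whenever it is positive; on a `p`-null `K` with `m d K ≥ scale d` the
  -- second layer has order at least `scale d ^ 2`. Since `scale d * ρ d` tends to zero, the cube
  -- makes the third layer negligible even there, while keeping every nonempty event eventually
  -- charged.
  let μ : Finset Ω × ℕ → Set Ω → ℝ := fun d F =>
    (p F + scale d * m d F) + scale d ^ 3 * ρ d F
  have hμ : ∀ d, IsFinAddMeasure A (μ d) := fun d =>
    (hp.finAdd.toMeasure.add_measure ((hm d).const_mul (hs d))).add_measure
      ((hρ d).const_mul (pow_nonneg (hs d) 3))
  let U : Ultrafilter (Finset Ω × ℕ) := Ultrafilter.of (atTop ×ˢ atTop)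
  have hU : (U : Filter (Finset Ω × ℕ)) ≤ atTop ×ˢ atTop := Ultrafilter.of_le _
  have hpos : ∀ K ∈ A, K.Nonempty → ∀ᶠ d in (U : Filter (Finset Ω × ℕ)), 0 < μ d K := by
    classical
    rintro K hK ⟨ω, hω⟩
    refine hU ?_
    filter_upwards [tendsto_fst.eventually (eventually_ge_atTop {ω})] with d hd
    have hd : ω ∈ d.1 := hd (by simp)
    have h1 : 0 < ρ d K := by
      refine Finset.sum_pos' (fun ω' _ => (isFinAddMeasure_tilt hσ (hs d)).nonneg K hK)
        ⟨ω, hd, ?_⟩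
      exact (scale_pos d).trans_le (le_tilt hσ hK hω)
    have h2 := mul_pos (pow_pos (scale_pos d) 3) h1
    have h3 := mul_nonneg (hs d) ((hm d).nonneg K hK)
    have h4 := hp.finAdd.nonneg K hK
    simp only [μ]
    linarith
  obtain ⟨P, hP, hlim⟩ := exists_isFullCondProb_tendsto U μ hμ hpos
  have hρ0 : ∀ k, k ≠ 0 → ∀ F ∈ A, Tendsto (fun d => scale d ^ k * ρ d F) U (𝓝 0) := by
    intro k hk F hF
    refine squeeze_zero (fun d => mul_nonneg (pow_nonneg (hs d) k) ((hρ d).nonneg F hF))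
      (fun d => ?_) ((tendsto_scale_mul_fullSupport hσ idx hF).mono_left hU)
    exact mul_le_mul_of_nonneg_right (pow_le_of_le_one (hs d) (scale_le_one d) hk)
      ((hρ d).nonneg F hF)
  have hsU : Tendsto (scale (Ω := Ω)) U (𝓝 0) := tendsto_scale.mono_left hU
  have hμp : ∀ F ∈ A, Tendsto (fun d => μ d F) U (𝓝 (p F)) := by
    intro F hF
    have h1 : Tendsto (fun d => scale d * m d F) U (𝓝 0) := by
      refine squeeze_zero (g := fun d => scale d * 2)
        (fun d => mul_nonneg (hs d) ((hm d).nonneg F hF))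
        (fun d => mul_le_mul_of_nonneg_left (((hm d).le_univ hF).trans (hm2 d)) (hs d)) ?_
      simpa using hsU.mul_const 2
    simpa [μ] using (h1.const_add (p F)).add (hρ0 3 (by norm_num) F hF)
  have huniv : (Set.univ : Set Ω).Nonempty := by
    by_contra h
    have h1 := hp.finAdd.univ_eq
    rw [Set.not_nonempty_iff_eq_empty.1 h, hp.finAdd.toMeasure.empty] at h1
    exact zero_ne_one h1
  have hPuniv : ∀ F ∈ A, P F Set.univ = p F := by
    intro F hF
    refine tendsto_nhds_unique (hlim F hF _ A.univ_mem huniv) ?_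
    have := (hμp F hF).div (hμp _ A.univ_mem) (by rw [hp.finAdd.univ_eq]; norm_num)
    rw [hp.finAdd.univ_eq, div_one] at this
    exact this.congr fun d => by simp only [Pi.div_apply, Set.inter_univ]
  refine ⟨P, ⟨hP, fun B hB => ?_, fun F hF i => ?_⟩, hPuniv, fun F hF K hK hKn hpK hmK r hr => ?_⟩
  · rw [hPuniv B (hH.le hB), hp.restrict B hB]
  · refine tendsto_nhds_unique (hlim F hF _ (hH.mem' i) (hH.nonempty i)) ?_
    rw [tendsto_iff_dist_tendsto_zero]
    refine squeeze_zero' (.of_forall fun d => dist_nonneg) ?_ hsU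
    filter_upwards [hpos _ (hH.mem' i) (hH.nonempty i), hU (hfol i)] with d hd hfd
    have h1 : FollowsUpTo A H σ (scale d) i (μ d) :=
      ((hp.followsUpTo hH (hs d) i).add_measure (hfd.const_mul (hs d))).add_measure
        (FollowsUpTo.const_mul
          (.finset_sum _ fun ω _ => followsUpTo_tilt hH hσ (hs d) (hidx ω) i)
          (pow_nonneg (hs d) 3))
    rw [Real.dist_eq, div_sub' hd.ne', abs_div, abs_of_pos hd, div_le_iff₀ hd, mul_comm (μ d (H i))]
    exact h1 F hF
  · refine tendsto_nhds_unique (hlim F hF K hK hKn) ?_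
    have hFK := A.inter_mem hF hK
    have hpFK : p (F ∩ K) = 0 :=
      hp.finAdd.toMeasure.eq_zero_of_subset hFK hK Set.inter_subset_right hpK
    have hmpos : ∀ d, 0 < m d K := fun d => (scale_pos d).trans_le (hmK d)
    -- The lower bound `scale d ≤ m d K` cancels one of the two factors `scale d`; the remaining one
    -- still beats the growth of `ρ d`.
    have hsmall : ∀ X ∈ A, Tendsto (fun d => scale d ^ 2 * ρ d X / m d K) U (𝓝 0) := by
      intro X hX
      refine squeeze_zero (fun d => div_nonneg (mul_nonneg (pow_nonneg (hs d) 2)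
        ((hρ d).nonneg X hX)) (hmpos d).le) (fun d => ?_) (hρ0 1 one_ne_zero X hX)
      rw [div_le_iff₀ (hmpos d)]
      have h1 := mul_le_mul_of_nonneg_left (hmK d) (mul_nonneg (hs d) ((hρ d).nonneg X hX))
      calc _ = scale d * ρ d X * scale d := by ring
        _ ≤ _ := by rw [pow_one]; exact h1
    have h1 := ((hr.mono_left hU).add (hsmall _ hFK)).div ((hsmall K hK).const_add 1) (by norm_num)
    rw [add_zero, add_zero, div_one] at h1
    refine h1.congr fun d => ?_
    have hm0 := (hmpos d).ne'
    have hs0 := (scale_pos d).ne'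
    simp only [Pi.div_apply, μ, hpFK, hpK, zero_add]
    have e1 : ∀ x y : ℝ, x / m d K + scale d ^ 2 * y / m d K =
        (scale d * x + scale d ^ 3 * y) / (scale d * m d K) := by
      intro x y
      field_simp
    have e2 : 1 + scale d ^ 2 * ρ d K / m d K =
        (scale d * m d K + scale d ^ 3 * ρ d K) / (scale d * m d K) := by
      field_simp
    rw [e1, e2, div_div_div_cancel_right₀ (mul_ne_zero hs0 hm0)]

end Extension

/-! ### Computation of the envelopes. -/

section Envelopes

open Filter Topology

variable {Ω ι : Type*} {A AL : BooleanSubalgebra (Set Ω)} {H : ι → Set Ω}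
  {π : Set Ω → ℝ} {σ : Set Ω → Set Ω → ℝ} {F K : Set Ω}

/-- The sets that cut no cell of the partition form an algebra closed under arbitrary unions and
containing the cells. -/
theorem subset_or_disjoint_of_mem_completeAlgebra (hH : IsPartition H) {B : Set Ω}
    (hB : B ∈ completeAlgebra (Set.range H)) (i : ι) : H i ⊆ B ∨ Disjoint (H i) B := by
  let C : BooleanSubalgebra (Set Ω) :=
    { carrier := {X | ∀ i, H i ⊆ X ∨ Disjoint (H i) X}
      supClosed' := by
        intro X hX Y hY i
        rcases hX i with h | h
        · exact Or.inl (h.trans Set.subset_union_left)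
        · rcases hY i with h' | h'
          · exact Or.inl (h'.trans Set.subset_union_right)
          · exact Or.inr (h.union_right h')
      infClosed' := by
        intro X hX Y hY i
        rcases hX i with h | h
        · rcases hY i with h' | h'
          · exact Or.inl (Set.subset_inter h h')
          · exact Or.inr (h'.mono_right Set.inter_subset_right)
        · exact Or.inr (h.mono_right Set.inter_subset_left)
      compl_mem' := by
        intro X hX i
        rcases hX i with h | h
        · exact Or.inr (Set.disjoint_compl_right_iff_subset.2 h)
        · exact Or.inl h.subset_compl_right
      bot_mem' := fun i => Or.inr disjoint_bot_right }
  refine hB C ?_ ?_ i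
  · rintro _ ⟨j, rfl⟩ i
    by_cases h : i = j
    · exact Or.inl (h ▸ subset_rfl)
    · exact Or.inr (hH.2.1 h)
  · intro T hT i
    by_cases h : ∃ X ∈ T, H i ⊆ X
    · obtain ⟨X, hX, hi⟩ := h
      exact Or.inl (hi.trans (Set.subset_sUnion_of_mem hX))
    · push Not at h
      exact Or.inr (Set.disjoint_sUnion_right.2 fun X hX => (hT hX i).resolve_left (h X hX))

theorem IsPartition.isAtomicPartition (hH : IsPartition H) (hle : AL ≤ A)
    (hAL : BooleanSubalgebra.closure (Set.range H) ≤ AL)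
    (hAL' : (AL : Set (Set Ω)) ⊆ completeAlgebra (Set.range H)) : IsAtomicPartition A AL H where
  le := hle
  mem i := hAL (BooleanSubalgebra.subset_closure ⟨i, rfl⟩)
  nonempty := hH.1
  disjoint := hH.2.1
  cover ω := Set.mem_iUnion.1 (hH.2.2 ▸ Set.mem_univ ω)
  subset_or_disjoint _ hB i := subset_or_disjoint_of_mem_completeAlgebra hH (hAL' hB) i

theorem isLeast_lowerJoint (hH : IsAtomicPartition A AL H) (hσ : IsStrategy A H σ)
    (hπ : IsFinAddProb AL π) (hF : F ∈ A) :
    IsLeast (jointValues A AL H π σ F) (lowerJoint A AL H π σ F) := by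
  obtain ⟨p, hp, hle⟩ := exists_isJoint_le hH hσ hπ hF hF subset_rfl
  have h : IsLeast (jointValues A AL H π σ F) (p F) := by
    refine ⟨⟨p, hp.mem_jointProbs hH hσ, rfl⟩, ?_⟩
    rintro _ ⟨q, hq, rfl⟩
    exact (hle q (.of_mem_jointProbs hH hq)).1
  rwa [lowerJoint, h.csInf_eq]

theorem IsJoint.add_compl {p : Set Ω → ℝ} (hp : IsJoint A AL H π σ p) (hF : F ∈ A) :
    p F + p Fᶜ = 1 := by
  rw [hp.finAdd.toMeasure.add_compl hF, hp.finAdd.univ_eq]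

theorem isGreatest_upperJoint (hH : IsAtomicPartition A AL H) (hσ : IsStrategy A H σ)
    (hπ : IsFinAddProb AL π) (hF : F ∈ A) :
    IsGreatest (jointValues A AL H π σ F) (upperJoint A AL H π σ F) := by
  obtain ⟨p, hp, hle⟩ := exists_isJoint_le hH hσ hπ (A.setCompl_mem hF) (A.setCompl_mem hF)
    subset_rfl
  have h : IsGreatest (jointValues A AL H π σ F) (p F) := by
    refine ⟨⟨p, hp.mem_jointProbs hH hσ, rfl⟩, ?_⟩
    rintro _ ⟨q, hq, rfl⟩
    have hq := IsJoint.of_mem_jointProbs hH hq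
    simp only
    linarith [(hle q hq).1, hp.add_compl hF, hq.add_compl hF]
  rwa [upperJoint, h.csSup_eq]

theorem IsJoint.lowerJoint_le (hH : IsAtomicPartition A AL H) (hσ : IsStrategy A H σ)
    (hπ : IsFinAddProb AL π) {p : Set Ω → ℝ} (hp : IsJoint A AL H π σ p) (hF : F ∈ A) :
    lowerJoint A AL H π σ F ≤ p F :=
  (isLeast_lowerJoint hH hσ hπ hF).2 ⟨p, hp.mem_jointProbs hH hσ, rfl⟩

theorem IsJoint.le_upperJoint (hH : IsAtomicPartition A AL H) (hσ : IsStrategy A H σ)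
    (hπ : IsFinAddProb AL π) {p : Set Ω → ℝ} (hp : IsJoint A AL H π σ p) (hF : F ∈ A) :
    p F ≤ upperJoint A AL H π σ F :=
  (isGreatest_upperJoint hH hσ hπ hF).2 ⟨p, hp.mem_jointProbs hH hσ, rfl⟩

theorem exists_isJoint_eq_lowerJoint (hH : IsAtomicPartition A AL H) (hσ : IsStrategy A H σ)
    (hπ : IsFinAddProb AL π) (hF : F ∈ A) :
    ∃ p, IsJoint A AL H π σ p ∧ p F = lowerJoint A AL H π σ F := by
  obtain ⟨p, hp, h⟩ := (isLeast_lowerJoint hH hσ hπ hF).1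
  exact ⟨p, .of_mem_jointProbs hH hp, h⟩

theorem exists_isJoint_eq_upperJoint (hH : IsAtomicPartition A AL H) (hσ : IsStrategy A H σ)
    (hπ : IsFinAddProb AL π) (hF : F ∈ A) :
    ∃ p, IsJoint A AL H π σ p ∧ p F = upperJoint A AL H π σ F := by
  obtain ⟨p, hp, h⟩ := (isGreatest_upperJoint hH hσ hπ hF).1
  exact ⟨p, .of_mem_jointProbs hH hp, h⟩

/-- For incompatible events, the lower probability of one and the upper probability of the other
are attained simultaneously. -/
theorem exists_isJoint_eq_lowerJoint_eq_upperJoint (hH : IsAtomicPartition A AL H)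
    (hσ : IsStrategy A H σ) (hπ : IsFinAddProb AL π) {X Y : Set Ω} (hX : X ∈ A) (hY : Y ∈ A)
    (hXY : Disjoint X Y) : ∃ p, IsJoint A AL H π σ p ∧ p X = lowerJoint A AL H π σ X ∧
      p Y = upperJoint A AL H π σ Y := by
  -- Minimising `Yᶜ` maximises `Y`, and disjointness makes `X ⊆ Yᶜ` a chain.
  obtain ⟨p, hp, hle⟩ := exists_isJoint_le hH hσ hπ hX (A.setCompl_mem hY) hXY.subset_compl_right
  obtain ⟨q, hq, hqX⟩ := exists_isJoint_eq_lowerJoint hH hσ hπ hX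
  obtain ⟨r, hr, hrY⟩ := exists_isJoint_eq_upperJoint hH hσ hπ hY
  refine ⟨p, hp, le_antisymm ?_ (hp.lowerJoint_le hH hσ hπ hX),
    le_antisymm (hp.le_upperJoint hH hσ hπ hY) ?_⟩
  · exact hqX ▸ (hle q hq).1
  · linarith [(hle r hr).2, hp.add_compl hY, hr.add_compl hY]

theorem disjoint_inter_compl_inter (F K : Set Ω) : Disjoint (F ∩ K) (Fᶜ ∩ K) :=
  disjoint_compl_right.mono Set.inter_subset_left Set.inter_subset_left

/-- The side condition costs nothing: a joint probability maximal on `Fᶜ ∩ K` can also attain the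
unconstrained minimum on `F ∩ K`. -/
theorem isLeast_lowerAuxValues (hH : IsAtomicPartition A AL H) (hσ : IsStrategy A H σ)
    (hπ : IsFinAddProb AL π) (hF : F ∈ A) (hK : K ∈ A) :
    IsLeast (lowerAuxValues A AL H π σ F K) (lowerJoint A AL H π σ (F ∩ K)) := by
  have hFK := A.inter_mem hF hK
  obtain ⟨p, hp, h1, h2⟩ := exists_isJoint_eq_lowerJoint_eq_upperJoint hH hσ hπ hFK
    (A.inter_mem (A.setCompl_mem hF) hK) (disjoint_inter_compl_inter F K)
  refine ⟨⟨p, ⟨hp.mem_jointProbs hH hσ, h2⟩, h1⟩, ?_⟩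
  rintro _ ⟨q, ⟨hq, _⟩, rfl⟩
  exact (IsJoint.of_mem_jointProbs hH hq).lowerJoint_le hH hσ hπ hFK

theorem lowerAux_eq (hH : IsAtomicPartition A AL H) (hσ : IsStrategy A H σ)
    (hπ : IsFinAddProb AL π) (hF : F ∈ A) (hK : K ∈ A) :
    lowerAux A AL H π σ F K = lowerJoint A AL H π σ (F ∩ K) :=
  (isLeast_lowerAuxValues hH hσ hπ hF hK).csInf_eq

theorem isGreatest_upperAuxValues (hH : IsAtomicPartition A AL H) (hσ : IsStrategy A H σ)
    (hπ : IsFinAddProb AL π) (hF : F ∈ A) (hK : K ∈ A) :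
    IsGreatest (upperAuxValues A AL H π σ F K) (upperJoint A AL H π σ (F ∩ K)) := by
  have hFK := A.inter_mem hF hK
  obtain ⟨p, hp, h1, h2⟩ := exists_isJoint_eq_lowerJoint_eq_upperJoint hH hσ hπ
    (A.inter_mem (A.setCompl_mem hF) hK) hFK (disjoint_inter_compl_inter F K).symm
  refine ⟨⟨p, ⟨hp.mem_jointProbs hH hσ, h1⟩, h2⟩, ?_⟩
  rintro _ ⟨q, ⟨hq, _⟩, rfl⟩
  exact (IsJoint.of_mem_jointProbs hH hq).le_upperJoint hH hσ hπ hFK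

theorem upperAux_eq (hH : IsAtomicPartition A AL H) (hσ : IsStrategy A H σ)
    (hπ : IsFinAddProb AL π) (hF : F ∈ A) (hK : K ∈ A) :
    upperAux A AL H π σ F K = upperJoint A AL H π σ (F ∩ K) :=
  (isGreatest_upperAuxValues hH hσ hπ hF hK).csSup_eq

/-- The chain rule at the sure event, through `H i`, is the disintegration identity. -/
theorem isJoint_of_mem_fullExtensions (hH : IsAtomicPartition A AL H) (hΩ : Nonempty Ω)
    {P : Set Ω → Set Ω → ℝ} (hP : P ∈ fullExtensions A AL H π σ) :
    IsJoint A AL H π σ (fun F => P F Set.univ) := by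
  obtain ⟨h1, h2, h3⟩ := hP
  refine ⟨h1.finAdd _ A.univ_mem Set.univ_nonempty, h2, fun F hF i => ?_⟩
  have := h1.chain (H i) (hH.mem' i) F hF _ A.univ_mem Set.univ_nonempty
    (by simpa using hH.nonempty i)
  rw [Set.inter_univ, h3 F hF, h2 _ (hH.mem i)] at this
  rw [Set.inter_comm, this, mul_comm]

theorem IsFullCondProb.univ_mul {P : Set Ω → Set Ω → ℝ} (hP : IsFullCondProb A P) (hF : F ∈ A)
    (hK : K ∈ A) (hKn : K.Nonempty) : P (F ∩ K) Set.univ = P K Set.univ * P F K := by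
  obtain ⟨ω, hω⟩ := hKn
  have := hP.chain K hK F hF _ A.univ_mem ⟨ω, Set.mem_univ ω⟩ ⟨ω, hω, Set.mem_univ ω⟩
  rwa [Set.inter_univ, Set.inter_comm] at this

/-- No control on null events is needed here, so the middle layer is zero. -/
theorem exists_fullExtension_eq (hH : IsAtomicPartition A AL H) (hσ : IsStrategy A H σ)
    {p : Set Ω → ℝ} (hp : IsJoint A AL H π σ p) :
    ∃ P ∈ fullExtensions A AL H π σ, ∀ F ∈ A, P F Set.univ = p F := by
  obtain ⟨P, hP, h, _⟩ := exists_fullExtension hH hσ hp (fun _ _ => 0) (fun _ => .zero)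
    (fun _ => by norm_num) (fun i => .of_forall fun _ => .of_eq_zero .zero (hH.mem' i) rfl)
  exact ⟨P, hP, h⟩

theorem isLeast_extensionValues_of_inter_eq (hH : IsAtomicPartition A AL H)
    (hσ : IsStrategy A H σ) (hπ : IsFinAddProb AL π) (hF : F ∈ A) (hK : K ∈ A)
    (hKn : K.Nonempty) (h : F ∩ K = K) : IsLeast (extensionValues A AL H π σ F K) 1 := by
  have key : ∀ P ∈ fullExtensions A AL H π σ, P F K = 1 := by
    rintro P ⟨hP, _⟩
    have h1 := hP.inter_cond _ A.univ_mem K hK hKn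
    rw [Set.univ_inter, (hP.finAdd K hK hKn).univ_eq] at h1
    rw [hP.inter_cond F hF K hK hKn, h, ← h1]
  obtain ⟨p, hp, _⟩ := exists_isJoint_eq_lowerJoint hH hσ hπ hK
  obtain ⟨P, hP, _⟩ := exists_fullExtension_eq hH hσ hp
  refine ⟨⟨P, hP, key P hP⟩, ?_⟩
  rintro _ ⟨Q, hQ, rfl⟩
  exact (key Q hQ).ge

theorem isLeast_extensionValues_of_pos (hH : IsAtomicPartition A AL H)
    (hσ : IsStrategy A H σ) (hπ : IsFinAddProb AL π) (hF : F ∈ A) (hK : K ∈ A)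
    (hKn : K.Nonempty) (h : 0 < lowerJoint A AL H π σ K) :
    IsLeast (extensionValues A AL H π σ F K) (lowerJoint A AL H π σ (F ∩ K) /
      (lowerJoint A AL H π σ (F ∩ K) + upperJoint A AL H π σ (Fᶜ ∩ K))) := by
  have hFK := A.inter_mem hF hK
  have hFK' := A.inter_mem (A.setCompl_mem hF) hK
  have hsplit : ∀ p, IsJoint A AL H π σ p → p (F ∩ K) + p (Fᶜ ∩ K) = p K := by
    intro p hp
    have := hp.finAdd.toMeasure.inter_add_diff hK hF
    rwa [Set.inter_comm, Set.sdiff_eq, Set.inter_comm K Fᶜ] at this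
  have hratio : ∀ P ∈ fullExtensions A AL H π σ, P F K = P (F ∩ K) Set.univ / P K Set.univ := by
    intro P hP
    have hp := isJoint_of_mem_fullExtensions hH ⟨hKn.some⟩ hP
    rw [hP.1.univ_mul hF hK hKn, mul_div_cancel_left₀]
    exact (h.trans_le (hp.lowerJoint_le hH hσ hπ hK)).ne'
  obtain ⟨p, hp, h1, h2⟩ := exists_isJoint_eq_lowerJoint_eq_upperJoint hH hσ hπ hFK hFK'
    (disjoint_inter_compl_inter F K)
  have hpK : 0 < p K := h.trans_le (hp.lowerJoint_le hH hσ hπ hK)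
  rw [← h1, ← h2]
  constructor
  · obtain ⟨P, hP, hPp⟩ := exists_fullExtension_eq hH hσ hp
    refine ⟨P, hP, ?_⟩
    simp only [hratio P hP]
    rw [hPp _ hFK, hPp _ hK, hsplit p hp]
  · rintro _ ⟨Q, hQ, rfl⟩
    have hq := isJoint_of_mem_fullExtensions hH ⟨hKn.some⟩ hQ
    have hqK : 0 < Q K Set.univ := h.trans_le (hq.lowerJoint_le hH hσ hπ hK)
    simp only [hratio Q hQ]
    have h3 := hq.lowerJoint_le hH hσ hπ hFK
    have h4 := hq.le_upperJoint hH hσ hπ hFK'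
    have h5 := hsplit _ hq
    rw [← h1] at h3
    rw [← h2] at h4
    -- After cross-multiplication the common product cancels, leaving `p(F ∩ K) q(Fᶜ ∩ K) ≤ q(F ∩ K)
    -- p(Fᶜ ∩ K)`, with `q` the joint probability of `Q`.
    rw [hsplit p hp, div_le_div_iff₀ hpK hqK, ← hsplit p hp, ← h5]
    have h6 := hp.finAdd.nonneg _ hFK
    have h7 := hq.finAdd.nonneg _ hFK'
    have h8 := mul_le_mul h3 h4 h7 (h6.trans h3)
    linarith

theorem exists_fullExtension_tilt (hH : IsAtomicPartition A AL H) (hσ : IsStrategy A H σ)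
    {p : Set Ω → ℝ} (hp : IsJoint A AL H π σ p) (hF : F ∈ A) (hK : K ∈ A) (hpK : p K = 0) {i : ι}
    {ω : Ω} (hωi : ω ∈ H i) (hωK : ω ∈ K) {r : ℝ}
    (hr : Tendsto (fun ε => tilt H σ ε i ω (F ∩ K) / tilt H σ ε i ω K) (𝓝[>] 0) (𝓝 r)) :
    r ∈ extensionValues A AL H π σ F K := by
  obtain ⟨P, hP, _, h⟩ := exists_fullExtension hH hσ hp (fun d => tilt H σ (scale d) i ω)
    (fun d => isFinAddMeasure_tilt hσ (scale_pos d).le)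
    (fun d => by rw [tilt_univ hσ]; linarith [scale_le_one d])
    (fun j => .of_forall fun d => followsUpTo_tilt hH hσ (scale_pos d).le hωi j)
  refine ⟨P, hP, h F hF K hK ⟨ω, hωK⟩ hpK (fun d => le_tilt hσ hK hωK) r (hr.comp ?_)⟩
  exact tendsto_nhdsWithin_iff.2 ⟨tendsto_scale, .of_forall scale_pos⟩

theorem isLeast_extensionValues_of_null (hH : IsAtomicPartition A AL H)
    (hσ : IsStrategy A H σ) (hπ : IsFinAddProb AL π) (hF : F ∈ A) (hK : K ∈ A)
    (h : lowerJoint A AL H π σ K = 0) (h3 : indexThree H F K = ∅)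
    (hfin : (indexTwo H F K).Finite) (hpos : ∀ i ∈ indexTwo H F K, 0 < σ K (H i)) {i₀ : ι}
    (hi₀ : i₀ ∈ indexTwo H F K) (hmin : ∀ i ∈ indexTwo H F K,
      σ (F ∩ K) (H i₀) / σ K (H i₀) ≤ σ (F ∩ K) (H i) / σ K (H i)) :
    IsLeast (extensionValues A AL H π σ F K) (σ (F ∩ K) (H i₀) / σ K (H i₀)) := by
  have hFK := A.inter_mem hF hK
  obtain ⟨ω, ⟨hωi, hωF⟩, hωK⟩ := Set.nonempty_iff_ne_empty.2 hi₀.2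
  constructor
  · obtain ⟨p, hp, hpK⟩ := exists_isJoint_eq_lowerJoint hH hσ hπ hK
    refine exists_fullExtension_tilt hH hσ hp hF hK (hpK.trans h) hωi hωK ?_
    have key : ∀ X, Tendsto (fun ε => tilt H σ ε i₀ ω X) (𝓝[>] 0) (𝓝 (σ X (H i₀))) := by
      intro X
      have h0 : Tendsto (fun ε : ℝ => ε) (𝓝[>] 0) (𝓝 0) := tendsto_nhdsWithin_of_tendsto_nhds
        tendsto_id
      simpa [tilt] using (h0.mul_const (pointMass ω X)).const_add (σ X (H i₀))
    exact (key _).div (key _) (hpos i₀ hi₀).ne'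
  · set r := σ (F ∩ K) (H i₀) / σ K (H i₀) with hr
    have hr1 : r ≤ 1 := (div_le_one (hpos i₀ hi₀)).2
      ((hσ.measure i₀).mono hFK hK Set.inter_subset_right)
    rintro _ ⟨P, ⟨hP, _, hPσ⟩, rfl⟩
    have hKn : K.Nonempty := ⟨ω, hωK⟩
    have hm := hP.finAdd K hK hKn
    have hmm := hm.toMeasure
    -- Since `σ(K|H i) > 0`, the chain rule determines `P(F|K ∩ H i)` as the ratio of strategy
    -- values, which is at least `r`.
    have hcell : ∀ i ∈ hfin.toFinset,
        P (K ∩ H i ∩ Fᶜ) K ≤ (1 - r) * P (K ∩ H i) K := by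
      intro i hi
      have hi := hfin.mem_toFinset.1 hi
      have hKi := A.inter_mem hK (hH.mem' i)
      have hKin : (K ∩ H i).Nonempty := by
        obtain ⟨ω', ⟨h1, _⟩, h2⟩ := Set.nonempty_iff_ne_empty.2 hi.2
        exact ⟨ω', h2, h1⟩
      have e0 : K ∩ H i ∩ K = K ∩ H i := by
        rw [Set.inter_right_comm, Set.inter_self]
      have e1 := hP.chain (K ∩ H i) hKi Fᶜ (A.setCompl_mem hF) K hK hKn (by rwa [e0])
      rw [e0] at e1
      have e2 := hP.chain K hK F hF (H i) (hH.mem' i) (hH.nonempty i) hKin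
      rw [Set.inter_comm, hPσ _ hFK, hPσ _ hK] at e2
      have e3 := (hP.finAdd _ hKi hKin).toMeasure.add_compl hF
      simp only [(hP.finAdd _ hKi hKin).univ_eq] at e3
      have e4 := hmin i hi
      rw [e2, mul_div_cancel_left₀ _ (hpos i hi).ne'] at e4
      rw [e1, mul_comm]
      exact mul_le_mul_of_nonneg_right (by linarith) (hmm.nonneg _ hKi)
    -- As `indexThree` is empty, every cell meeting `Fᶜ ∩ K` has its index in `indexTwo`; finiteness
    -- then allows summing `P(·|K)` over cells.
    have hcover : Fᶜ ∩ K = ⋃ i ∈ hfin.toFinset, K ∩ H i ∩ Fᶜ := by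
      ext ω'
      simp only [Set.mem_inter_iff, Set.mem_iUnion, Set.Finite.mem_toFinset, exists_prop]
      constructor
      · rintro ⟨h1, h2⟩
        obtain ⟨i, hi⟩ := hH.cover ω'
        have hne : H i ∩ Fᶜ ∩ K ≠ ∅ := Set.nonempty_iff_ne_empty.1 ⟨ω', ⟨hi, h1⟩, h2⟩
        refine ⟨i, ⟨fun h0 => ?_, hne⟩, ⟨h2, hi⟩, h1⟩
        exact Set.eq_empty_iff_forall_notMem.1 h3 i ⟨h0, hne⟩
      · rintro ⟨i, _, ⟨h2, _⟩, h1⟩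
        exact ⟨h1, h2⟩
    have hdisj : ∀ X : ι → Set Ω, (∀ i, X i ⊆ H i) →
        (hfin.toFinset : Set ι).PairwiseDisjoint X := fun X hX i _ j _ hij =>
      (hH.disjoint hij).mono (hX i) (hX j)
    have hsum1 : P (Fᶜ ∩ K) K ≤ (1 - r) * ∑ i ∈ hfin.toFinset, P (K ∩ H i) K := by
      rw [hcover, Finset.mul_sum]
      refine (hmm.biUnion hfin.toFinset (fun i => K ∩ H i ∩ Fᶜ)
        (fun i _ => A.inter_mem (A.inter_mem hK (hH.mem' i)) (A.setCompl_mem hF))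
        (hdisj _ fun i x hx => hx.1.2)).le.trans (Finset.sum_le_sum hcell)
    have hKA : ∀ i ∈ hfin.toFinset, K ∩ H i ∈ A := fun i _ => A.inter_mem hK (hH.mem' i)
    have hsum2 : ∑ i ∈ hfin.toFinset, P (K ∩ H i) K ≤ 1 := by
      rw [← hmm.biUnion hfin.toFinset (fun i => K ∩ H i) hKA (hdisj _ fun i x hx => hx.2),
        ← hm.univ_eq]
      exact hmm.le_univ (A.biUnion_mem _ _ hKA)
    have h4 := hmm.add_compl hF
    simp only [hm.univ_eq] at h4
    rw [hP.inter_cond _ (A.setCompl_mem hF) K hK hKn] at h4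
    have h5 := mul_le_mul_of_nonneg_left hsum2 (sub_nonneg.2 hr1)
    simp only
    linarith

theorem isLeast_extensionValues_zero (hH : IsAtomicPartition A AL H)
    (hσ : IsStrategy A H σ) (hπ : IsFinAddProb AL π) (hF : F ∈ A) (hK : K ∈ A)
    (hFK : F ∩ K ≠ K) (h : lowerJoint A AL H π σ K = 0)
    (hnot : ¬ ((indexTwo H F K).Nonempty ∧ indexThree H F K = ∅ ∧ (indexTwo H F K).Finite ∧
      ∀ i ∈ indexTwo H F K, 0 < σ K (H i))) :
    IsLeast (extensionValues A AL H π σ F K) 0 := by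
  have hFK' := A.inter_mem hF hK
  obtain ⟨ω₀, hω₀K, hω₀F⟩ : ∃ ω ∈ K, ω ∉ F := by
    by_contra! hcon
    exact hFK (Set.inter_eq_right.2 hcon)
  obtain ⟨p, hp, hpK⟩ := exists_isJoint_eq_lowerJoint hH hσ hπ hK
  rw [h] at hpK
  constructor
  swap
  · rintro _ ⟨P, ⟨hP, _⟩, rfl⟩
    exact (hP.finAdd K hK ⟨ω₀, hω₀K⟩).nonneg F hF
  -- Tilting towards a point of `Fᶜ ∩ K` charges `K` but leaves `F ∩ K` null, so the ratio is
  -- exactly zero at every scale.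
  have htilt : ∀ i, H i ∩ Fᶜ ∩ K ≠ ∅ → σ (F ∩ K) (H i) = 0 →
      (0 : ℝ) ∈ extensionValues A AL H π σ F K := by
    intro i hi h0
    obtain ⟨ω, ⟨hωi, hωF⟩, hωK⟩ := Set.nonempty_iff_ne_empty.2 hi
    refine exists_fullExtension_tilt hH hσ hp hF hK hpK hωi hωK
      (tendsto_const_nhds.congr fun ε => ?_)
    rw [tilt, h0, pointMass_of_notMem fun hh => hωF hh.1, mul_zero, add_zero, zero_div]
  by_cases h3 : indexThree H F K = ∅
  swap
  · obtain ⟨i, hi1, hi2⟩ := Set.nonempty_iff_ne_empty.2 h3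
    refine htilt i hi2 (hσ.eq_zero_of_disjoint hH hFK' ?_)
    rw [Set.disjoint_iff_inter_eq_empty, Set.inter_comm, ← Set.inter_assoc, hi1]
  by_cases hpos : ∀ i ∈ indexTwo H F K, 0 < σ K (H i)
  swap
  · push Not at hpos
    obtain ⟨i, hi, hle⟩ := hpos
    refine htilt i hi.2 ((hσ.measure i).eq_zero_of_subset hFK' hK Set.inter_subset_right ?_)
    exact le_antisymm hle ((hσ.measure i).nonneg K hK)
  -- Nonemptiness is automatic here, so infinitude of `indexTwo` is the only remaining failure.
  have h2 : (indexTwo H F K).Nonempty := by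
    obtain ⟨i, hi⟩ := hH.cover ω₀
    have hne : H i ∩ Fᶜ ∩ K ≠ ∅ := Set.nonempty_iff_ne_empty.1 ⟨ω₀, ⟨hi, hω₀F⟩, hω₀K⟩
    exact ⟨i, fun h0 => Set.eq_empty_iff_forall_notMem.1 h3 i ⟨h0, hne⟩, hne⟩
  have hinf : (indexTwo H F K).Infinite := fun hfin => hnot ⟨h2, h3, hfin, hpos⟩
  classical
  choose idx hidx using hH.cover
  -- Infinitely many cells meet `Fᶜ ∩ K`, so a point of it can be chosen outside the finitely many
  -- cells visited by `d.1`. Each fixed `H i` is then eventually null for the point mass, which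
  -- therefore respects `σ` while being concentrated on `Fᶜ ∩ K`.
  have hex : ∀ d : Finset Ω × ℕ, ∃ ω, ω ∈ Fᶜ ∩ K ∧ ∀ ω' ∈ d.1, ω ∉ H (idx ω') := by
    intro d
    obtain ⟨i, hi, hid⟩ := hinf.exists_notMem_finset (d.1.image idx)
    obtain ⟨ω, ⟨hωi, hωF⟩, hωK⟩ := Set.nonempty_iff_ne_empty.2 hi.2
    refine ⟨ω, ⟨hωF, hωK⟩, fun ω' hω' hcon => hid ?_⟩
    exact Finset.mem_image.2 ⟨ω', hω', hH.eq_of_mem hcon hωi⟩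
  choose pt hpt hpt' using hex
  obtain ⟨P, hP, _, hPr⟩ := exists_fullExtension hH hσ hp (fun d => pointMass (pt d))
    (fun d => (isFinAddProb_pointMass _).toMeasure)
    (fun d => (pointMass_le_one _ _).trans one_le_two) (fun i => by
      obtain ⟨ω, hω⟩ := hH.nonempty i
      filter_upwards [tendsto_fst.eventually (eventually_ge_atTop {ω})] with d hd
      refine .of_eq_zero (isFinAddProb_pointMass _).toMeasure (hH.mem' i) (pointMass_of_notMem ?_)
      rw [hH.eq_of_mem hω (hidx ω)]
      exact hpt' d ω (hd (by simp)))
  refine ⟨P, hP, hPr F hF K hK ⟨ω₀, hω₀K⟩ hpK (fun d => ?_) 0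
    (tendsto_const_nhds.congr fun d => ?_)⟩
  · rw [pointMass_of_mem (hpt d).2]
    exact scale_le_one d
  · rw [pointMass_of_notMem fun hh => (hpt d).1 hh.1, zero_div]

end Envelopes

/-! ### The main theorem. -/

theorem theorem2 {Ω I J : Type*}
    (H : I → Set Ω) (hH : IsPartition H) (E : J → Set Ω) (hE : IsPartition E)
    (AL AE A : BooleanSubalgebra (Set Ω))
    (hAL : BooleanSubalgebra.closure (Set.range H) ≤ AL)
    (hAL' : (AL : Set (Set Ω)) ⊆ completeAlgebra (Set.range H))
    (hAE : BooleanSubalgebra.closure (Set.range E) ≤ AE)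
    (hAE' : (AE : Set (Set Ω)) ⊆ completeAlgebra (Set.range E))
    (hA : BooleanSubalgebra.closure ((AL : Set (Set Ω)) ∪ (AE : Set (Set Ω))) ≤ A)
    (hA' : (A : Set (Set Ω)) ⊆ completeAlgebra ((AL : Set (Set Ω)) ∪ (AE : Set (Set Ω))))
    (σ : Set Ω → Set Ω → ℝ) (hσ : IsStrategy A H σ)
    (π : Set Ω → ℝ) (hπ : IsFinAddProb AL π) :
    -- the envelopes and the auxiliary functions are attained minima and maxima
    (∀ F ∈ A, IsLeast (jointValues A AL H π σ F) (lowerJoint A AL H π σ F) ∧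
      IsGreatest (jointValues A AL H π σ F) (upperJoint A AL H π σ F)) ∧
    (∀ F ∈ A, ∀ K ∈ A, K ≠ ∅ →
      IsLeast (lowerAuxValues A AL H π σ F K) (lowerAux A AL H π σ F K) ∧
      IsGreatest (upperAuxValues A AL H π σ F K) (upperAux A AL H π σ F K) ∧
      IsLeast (extensionValues A AL H π σ F K) (lowerEnvelope A AL H π σ F K)) ∧
    -- the closed form of the lower envelope
    (∀ F ∈ A, ∀ K ∈ A, K ≠ ∅ →
      (F ∩ K = K → lowerEnvelope A AL H π σ F K = 1) ∧
      (F ∩ K ≠ K →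
        (0 < lowerJoint A AL H π σ K →
          lowerEnvelope A AL H π σ F K =
            min
              (lowerJoint A AL H π σ (F ∩ K) /
                (lowerJoint A AL H π σ (F ∩ K) + upperAux A AL H π σ Fᶜ K))
              (lowerAux A AL H π σ F K /
                (lowerAux A AL H π σ F K + upperJoint A AL H π σ (Fᶜ ∩ K)))) ∧
        (lowerJoint A AL H π σ K = 0 →
          (((indexTwo H F K).Nonempty ∧ indexThree H F K = ∅ ∧ (indexTwo H F K).Finite ∧
              ∀ i ∈ indexTwo H F K, 0 < σ K (H i)) →
            IsLeast ((fun i => σ (F ∩ K) (H i) / σ K (H i)) '' indexTwo H F K)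
              (lowerEnvelope A AL H π σ F K)) ∧
          (¬ ((indexTwo H F K).Nonempty ∧ indexThree H F K = ∅ ∧ (indexTwo H F K).Finite ∧
              ∀ i ∈ indexTwo H F K, 0 < σ K (H i)) →
            lowerEnvelope A AL H π σ F K = 0)))) := by
  have hle : AL ≤ A := fun X hX => hA (BooleanSubalgebra.subset_closure (Or.inl hX))
  have hP := hH.isAtomicPartition hle hAL hAL'
  have hnonneg : ∀ K ∈ A, 0 ≤ lowerJoint A AL H π σ K := by
    intro K hK
    obtain ⟨p, hp, h⟩ := exists_isJoint_eq_lowerJoint hP hσ hπ hK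
    exact h ▸ hp.finAdd.nonneg K hK
  have hmin : ∀ F K, (indexTwo H F K).Finite → (indexTwo H F K).Nonempty →
      ∃ i₀ ∈ indexTwo H F K, ∀ i ∈ indexTwo H F K,
        σ (F ∩ K) (H i₀) / σ K (H i₀) ≤ σ (F ∩ K) (H i) / σ K (H i) := fun F K h2 h1 =>
    Set.exists_min_image _ (fun i => σ (F ∩ K) (H i) / σ K (H i)) h2 h1
  refine ⟨fun F hF => ⟨isLeast_lowerJoint hP hσ hπ hF, isGreatest_upperJoint hP hσ hπ hF⟩,
    fun F hF K hK hKn => ⟨?_, ?_, ?_⟩, fun F hF K hK hKn => ⟨fun h => ?_, fun h =>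
      ⟨fun hpos => ?_, fun h0 => ⟨fun ⟨h1, h2, h3, h4⟩ => ?_, fun hnot => ?_⟩⟩⟩⟩
  · exact lowerAux_eq hP hσ hπ hF hK ▸ isLeast_lowerAuxValues hP hσ hπ hF hK
  · exact upperAux_eq hP hσ hπ hF hK ▸ isGreatest_upperAuxValues hP hσ hπ hF hK
  · have hKn := Set.nonempty_iff_ne_empty.2 hKn
    obtain ⟨r, hr⟩ : ∃ r, IsLeast (extensionValues A AL H π σ F K) r := by
      by_cases h : F ∩ K = K
      · exact ⟨_, isLeast_extensionValues_of_inter_eq hP hσ hπ hF hK hKn h⟩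
      rcases (hnonneg K hK).lt_or_eq with hpos | h0
      · exact ⟨_, isLeast_extensionValues_of_pos hP hσ hπ hF hK hKn hpos⟩
      by_cases hc : (indexTwo H F K).Nonempty ∧ indexThree H F K = ∅ ∧
          (indexTwo H F K).Finite ∧ ∀ i ∈ indexTwo H F K, 0 < σ K (H i)
      · obtain ⟨h1, h2, h3, h4⟩ := hc
        obtain ⟨i₀, hi₀, hle⟩ := hmin F K h3 h1
        exact ⟨_, isLeast_extensionValues_of_null hP hσ hπ hF hK h0.symm h2 h3 h4 hi₀ hle⟩
      · exact ⟨_, isLeast_extensionValues_zero hP hσ hπ hF hK h h0.symm hc⟩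
    rwa [lowerEnvelope, hr.csInf_eq]
  · exact (isLeast_extensionValues_of_inter_eq hP hσ hπ hF hK
      (Set.nonempty_iff_ne_empty.2 hKn) h).csInf_eq
  · rw [upperAux_eq hP hσ hπ (A.setCompl_mem hF) hK, lowerAux_eq hP hσ hπ hF hK, min_self]
    exact (isLeast_extensionValues_of_pos hP hσ hπ hF hK
      (Set.nonempty_iff_ne_empty.2 hKn) hpos).csInf_eq
  · obtain ⟨i₀, hi₀, hle⟩ := hmin F K h3 h1
    rw [lowerEnvelope, (isLeast_extensionValues_of_null hP hσ hπ hF hK h0 h2 h3 h4 hi₀ hle).csInf_eq]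
    refine ⟨⟨i₀, hi₀, rfl⟩, ?_⟩
    rintro _ ⟨i, hi, rfl⟩
    exact hle i hi
  · exact (isLeast_extensionValues_zero hP hσ hπ hF hK h h0 hnot).csInf_eq
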